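/- Let $k$ be a field, let $X\subset\mathbb{P}^n_k$ be a (reduced and irreducible) projective variety with homogeneous coordinate ring $A=k[x_0,\dots,x_n]/P$, and let $K(A)$ be the field of fractions of $A$. A rational map $\mathfrak{F}\colon X\dashrightarrow\mathbb{P}^m_k$ is given by forms $f_0,\dots,f_m\in A$ of the same degree $\delta$, not all zero; such a tuple is called a representative of $\mathfrak{F}$ of degree $\delta$, and two tuples represent the same map if and only if they are homogeneous coordinates of the same point of $\mathbb{P}^m_{K(A)}$. A base ideal of $\mathfrak{F}$ is the ideal $(f_0,\dots,f_m)\subset A$ generated by the coordinates of a representative. For a graded $A$-module $M$ let $$\operatorname{reg}(M)=\sup_{i\ge 0}\bigl\{\operatorname{end}\bigl(H^i_{A_+}(M)\bigr)+i\bigr\},\qquad \operatorname{end}(N)=\sup\{e : N_e\neq 0\},$$ denote its Castelnuovo--Mumford regularity. Let $I,J\subset A$ be two base ideals of the same rational map $\mathfrak{F}$, coming from representatives of degrees $\delta_I$ and $\delta_J$, respectively. Then $$\operatorname{reg}(I^r)-r\,\delta_I=\operatorname{reg}(J^r)-r\,\delta_J\qquad\text{for every } r\ge 1.$$ Thus there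 is an integer-valued function $f$ of $r\geq 1$, depending only on $\mathfrak{F}$, such that $f(r)=\operatorname{reg}(I^r)-r\,\delta_I$ for every base ideal $I$ of $\mathfrak{F}$ and every $r\ge1$. -/

import Mathlib

open scoped LinearAlgebra.Projectivization

noncomputable section

/-! ### Graded local cohomology through the Čech complex -/

namespace Cech

variable {R : Type*} [CommRing R] {N : ℕ} (x : Fin N → R) (M : Type*) [AddCommGroup M] [Module R M]

/-- The multiplicative set of the powers of `x_S = ∏_{i ∈ S} x_i`. -/
abbrev pows (S : Finset (Fin N)) : Submonoid R := Submonoid.powers (∏ i ∈ S, x i)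

/-- The localized module `M_{x_S}`. -/
abbrev Loc (S : Finset (Fin N)) := LocalizedModule (pows x S) M

theorem isUnit_pows {S T : Finset (Fin N)} (h : S ⊆ T) (s : pows x S) :
    IsUnit (algebraMap R (Module.End R (Loc x M T)) s) := by
  obtain ⟨_, a, rfl⟩ := s
  have hT := IsLocalizedModule.map_units (LocalizedModule.mkLinearMap (pows x T) M)
    ⟨_, Submonoid.mem_powers (∏ i ∈ T, x i)⟩
  obtain ⟨c, hc⟩ := Finset.prod_dvd_prod_of_subset S T x h
  simp only [hc, map_mul] at hT
  simp only [map_pow]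
  exact (((Commute.all _ _).map (algebraMap R (Module.End R (Loc x M T)))).isUnit_mul_iff.1 hT).1.pow a

/-- The localization map `M_{x_S} → M_{x_T}`, for `S ⊆ T`. -/
def res {S T : Finset (Fin N)} (h : S ⊆ T) : Loc x M S →ₗ[R] Loc x M T :=
  LocalizedModule.lift (pows x S) (LocalizedModule.mkLinearMap (pows x T) M) (isUnit_pows x M h)

/-- The total space `⨁_S M_{x_S}` of the Čech complex of `M` with respect to `x`. -/
abbrev Cochains := (S : Finset (Fin N)) → Loc x M S

/-- The Čech differential
`(d c)_T = ∑_{i ∈ T} (-1)^{#{j ∈ T : j < i}} c_{T ∖ {i}}`. -/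
def d : Cochains x M →ₗ[R] Cochains x M :=
  LinearMap.pi fun T => ∑ i ∈ T, ((-1 : R) ^ (T.filter (· < i)).card) •
    (res x M (T.erase_subset i)).comp (LinearMap.proj (T.erase i))

theorem res_res {S T U : Finset (Fin N)} (h : S ⊆ T) (h' : T ⊆ U) (u : Loc x M S) :
    res x M h' (res x M h u) = res x M (h.trans h') u := by
  have : (res x M h').comp (res x M h) = res x M (h.trans h') := by
    apply IsLocalizedModule.ext (pows x S) (LocalizedModule.mkLinearMap (pows x S) M)
    · exact fun s => isUnit_pows x M (h.trans h') s
    · ext m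
      simp [res, LocalizedModule.mkLinearMap_apply]
  exact congrArg (· u) this

theorem d_apply (c : Cochains x M) (T : Finset (Fin N)) :
    d x M c T = ∑ i ∈ T, ((-1 : R) ^ (T.filter (· < i)).card) •
      res x M (T.erase_subset i) (c (T.erase i)) := by
  simp [d]

theorem sign_swap {T : Finset (Fin N)} {i j : Fin N} (hi : i ∈ T) (hij : i < j) :
    (-1 : R) ^ (T.filter (· < i)).card * (-1 : R) ^ ((T.erase i).filter (· < j)).card +
      (-1 : R) ^ (T.filter (· < j)).card * (-1 : R) ^ ((T.erase j).filter (· < i)).card = 0 := by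
  have h1 : ((T.erase i).filter (· < j)) = (T.filter (· < j)).erase i := by
    ext a; simp; tauto
  have h2 : ((T.erase j).filter (· < i)) = T.filter (· < i) := by
    ext a; simp only [Finset.mem_filter, Finset.mem_erase]
    constructor
    · tauto
    · rintro ⟨h, h'⟩
      exact ⟨⟨(h'.trans hij).ne, h⟩, h'⟩
  have hm : i ∈ T.filter (· < j) := by simp [hi, hij]
  rw [h1, h2, ← Finset.card_erase_add_one hm, pow_succ]
  ring

/-- The Čech complex is a complex. -/
theorem d_d (c : Cochains x M) : d x M (d x M c) = 0 := by
  funext T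
  have key : d x M (d x M c) T = ∑ q ∈ T.sigma fun i => T.erase i,
      ((-1 : R) ^ (T.filter (· < q.1)).card * (-1 : R) ^ ((T.erase q.1).filter (· < q.2)).card) •
        res x M (((T.erase q.1).erase_subset q.2).trans (T.erase_subset q.1))
          (c ((T.erase q.1).erase q.2)) := by
    rw [d_apply, Finset.sum_sigma]
    refine Finset.sum_congr rfl fun i _ => ?_
    rw [d_apply, map_sum, Finset.smul_sum]
    refine Finset.sum_congr rfl fun j _ => ?_
    rw [map_smul, res_res, smul_smul]
  rw [key]
  have swap : ∀ (i j : Fin N), res x M (((T.erase i).erase_subset j).trans (T.erase_subset i))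
      (c ((T.erase i).erase j)) = res x M (((T.erase j).erase_subset i).trans (T.erase_subset j))
      (c ((T.erase j).erase i)) := by
    intro i j
    have : ∀ (S S' : Finset (Fin N)) (e : S = S') (h : S ⊆ T) (h' : S' ⊆ T),
        res x M h (c S) = res x M h' (c S') := by
      rintro S _ rfl _ _; rfl
    exact this _ _ Finset.erase_right_comm _ _
  refine Finset.sum_involution (fun q _ => ⟨q.2, q.1⟩) ?_ ?_ ?_ ?_
  · rintro ⟨i, j⟩ h
    simp only [Finset.mem_sigma, Finset.mem_erase] at h
    obtain ⟨hi, hji, hj⟩ := h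
    dsimp only
    rw [swap j i, ← add_smul]
    rcases lt_or_gt_of_ne hji with h | h
    · rw [add_comm, sign_swap hj h, zero_smul]
    · rw [sign_swap hi h, zero_smul]
  · rintro ⟨i, j⟩ h _ e
    simp only [Finset.mem_sigma, Finset.mem_erase] at h
    simp only [Sigma.mk.injEq, heq_eq_eq] at e
    exact h.2.1 e.1
  · rintro ⟨i, j⟩ h
    simp only [Finset.mem_sigma, Finset.mem_erase] at h ⊢
    exact ⟨h.2.2, fun e => h.2.1 e.symm, h.1⟩
  · rintro ⟨i, j⟩ h
    rfl

/-- The `p`-cochains `⨁_{#S = p} M_{x_S}`. -/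
def cochains (p : ℕ) : Submodule R (Cochains x M) where
  carrier := {c | ∀ S : Finset (Fin N), S.card ≠ p → c S = 0}
  add_mem' ha hb S hS := by simp [ha S hS, hb S hS]
  zero_mem' _ _ := rfl
  smul_mem' a c hc S hS := by simp [hc S hS]

/-- The `p`-cocycles. -/
def cocycles (p : ℕ) : Submodule R (Cochains x M) := cochains x M p ⊓ LinearMap.ker (d x M)

/-- The `p`-coboundaries: images of `(p-1)`-cochains (none but zero if `p = 0`). -/
def coboundaries (p : ℕ) : Submodule R (Cochains x M) :=
  match p with
  | 0 => ⊥
  | q + 1 => (cochains x M q).map (d x M)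

/-- The `p`-th local cohomology module `H^p_{(x)}(M)`, as Čech cohomology. -/
abbrev H (p : ℕ) := cocycles x M p ⧸ (coboundaries x M p).comap (cocycles x M p).subtype

variable {M}

/-- The elements of degree `e` of `M_{x_S}`, where `M` is graded by `ℳ` and every `x_i` has
degree one: the fractions `m / x_S ^ a` with `m` of degree `e + a * #S`. -/
def locDeg (ℳ : ℤ → AddSubgroup M) (S : Finset (Fin N)) (e : ℤ) : Set (Loc x M S) :=
  {u | ∃ (a : ℕ) (y : M), y ∈ ℳ (e + a * S.card) ∧
    u = LocalizedModule.mk y ((⟨∏ i ∈ S, x i, Submonoid.mem_powers _⟩ : pows x S) ^ a)}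

/-- The graded piece `H^p_{(x)}(M)_e`: classes of the cocycles all of whose components have
degree `e`. -/
def HDeg (ℳ : ℤ → AddSubgroup M) (p : ℕ) (e : ℤ) : Set (H x M p) :=
  {h | ∃ z : cocycles x M p, (∀ S, z.1 S ∈ locDeg x ℳ S e) ∧ Submodule.Quotient.mk z = h}

/-- `end (H^p_{(x)}(M)) = sup {e | H^p_{(x)}(M)_e ≠ 0}`, with `sup ∅ = -∞`. -/
def endH (ℳ : ℤ → AddSubgroup M) (p : ℕ) : EReal :=
  ⨆ (e : ℤ) (_ : ∃ h ∈ HDeg x ℳ p e, h ≠ 0), ((e : ℝ) : EReal)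

/-- The Castelnuovo–Mumford regularity `sup_p (end (H^p_{(x)}(M)) + p)`. -/
def reg (ℳ : ℤ → AddSubgroup M) : EReal := ⨆ p : ℕ, endH x ℳ p + (p : EReal)

end Cech

/-! ### Projective varieties and rational maps to projective space -/

attribute [local instance] MvPolynomial.gradedAlgebra

/-- A (closed, reduced and irreducible) subvariety of `ℙ^n` over `k`, given by its homogeneous
prime ideal, which does not contain all the variables. -/
structure ProjVariety (k : Type*) [Field k] (n : ℕ) where
  /-- the homogeneous ideal of the variety -/
  ideal : Ideal (MvPolynomial (Fin (n + 1)) k)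
  isPrime : ideal.IsPrime
  isHomogeneous : ideal.IsHomogeneous (MvPolynomial.homogeneousSubmodule (Fin (n + 1)) k)
  exists_X_notMem : ∃ i, MvPolynomial.X i ∉ ideal

namespace ProjVariety

variable {k : Type*} [Field k] {n : ℕ} (X : ProjVariety k n)

instance : X.ideal.IsPrime := X.isPrime

/-- The homogeneous coordinate ring `A = k[x_0, …, x_n] / P`. -/
abbrev Coord := MvPolynomial (Fin (n + 1)) k ⧸ X.ideal

/-- The total ring of fractions `K(A)`; it is a field. -/
abbrev K := FractionRing X.Coord

/-- The classes of the variables in `A`; they generate the irrelevant ideal `A_+`. -/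
def var (i : Fin (n + 1)) : X.Coord := Ideal.Quotient.mk X.ideal (MvPolynomial.X i)

/-- The forms of degree `δ` in `A`. -/
def forms (δ : ℕ) : Submodule k X.Coord :=
  (MvPolynomial.homogeneousSubmodule (Fin (n + 1)) k δ).map
    (Ideal.Quotient.mkₐ k X.ideal).toLinearMap

/-- The grading of `A`, indexed by all the integers. -/
def deg : ℤ → AddSubgroup X.Coord
  | Int.ofNat e => (X.forms e).toAddSubgroup
  | Int.negSucc _ => ⊥

/-- The regularity of an ideal `I` of `A`, regarded as a graded `A`-module with the grading
`I_e = I ∩ A_e`: the regularity with respect to local cohomology with support in `A_+`. -/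
def reg (I : Ideal X.Coord) : EReal :=
  Cech.reg X.var (M := I) fun e => (X.deg e).comap (I.subtype : I →+ X.Coord)

/-- `f = (f_0, …, f_m)` is a tuple of forms of degree `δ` of `A`, not all zero, that are
homogeneous coordinates of the point `P` of `ℙ^m` over `K(A)`. -/
def IsRepresentative {m : ℕ} (P : ℙ X.K (Fin (m + 1) → X.K)) (δ : ℕ)
    (f : Fin (m + 1) → X.Coord) : Prop :=
  (∀ j, f j ∈ X.forms δ) ∧
    ∃ h : (fun j => algebraMap X.Coord X.K (f j)) ≠ 0, Projectivization.mk X.K _ h = P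

/-- A rational map from `X` to `ℙ^m`: it is given by forms `f_0, …, f_m` of `A` of the same degree,
not all zero, and two such tuples give the same map if and only if they are homogeneous coordinates
of the same point of `ℙ^m` over `K(A)`. -/
structure RationalMap (m : ℕ) where
  /-- the point of projective space over `K(A)` that corresponds to the map -/
  point : ℙ X.K (Fin (m + 1) → X.K)
  exists_representative : ∃ δ f, X.IsRepresentative point δ f

/-- `I` is a base ideal of the rational map `F`: the ideal generated by the coordinates of some
representative of `F` of degree `δ`. -/
def RationalMap.IsBaseIdeal {X : ProjVariety k n} {m : ℕ} (F : X.RationalMap m)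
    (δ : ℕ) (I : Ideal X.Coord) : Prop :=
  ∃ f, X.IsRepresentative F.point δ f ∧ I = Ideal.span (Set.range f)

end ProjVariety

end

/-! Two representatives f and g of the same map are proportional over K(A), so g_i f_j = f_i g_j for
all j, where i is chosen with f_i ≠ 0; then g_i ≠ 0 as well. Hence g_i I = f_i J, and g_i^r I^r =
f_i^r J^r. Since A is a domain, multiplication by a nonzero form of degree d is an isomorphism from
an ideal onto its multiple that raises degrees by d, so it adds d to the regularity. Comparing both
sides gives reg(I^r) + r δ_J = reg(J^r) + r δ_I (`exists_span_singleton_mul_eq`,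
`reg_span_singleton_mul`, `reg_pow_add`).

Passing to differences, and getting an integer, requires reg(I^r) to be finite, and this takes most
of the work. For a nonzero finitely generated graded module M with degrees bounded below, the
modules H^p(M) vanish in all high degrees (`exists_forall_vanishes_quot`), vanish for p larger than
the number of variables, and are not all zero (`eq_top_of_forall_vanishes`). Both main facts are
proved for the quotients M/K by Noetherian induction on the homogeneous submodule K. Either M/K has
a nonzero element killed by all variables, or homogeneous prime avoidance gives a form f of positive
degree d that is regular on M/K, and then (M/K)(-d) → M/K has cokernel M/K' with K' larger. The
tools are three pieces of the long exact cohomology sequence, proved degree by degree on Čech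
cochains, and the fact that each class is killed by a power of f. -/

noncomputable section
/-! ### Fractions in the terms of the Čech complex -/

namespace Cech

section Fractions

variable {R : Type*} [CommRing R] {N : ℕ} (x : Fin N → R)
  {L M P : Type*} [AddCommGroup L] [Module R L] [AddCommGroup M] [Module R M]
  [AddCommGroup P] [Module R P]

/-- The fraction `y / x_S ^ a`. -/
def frac (S : Finset (Fin N)) (y : M) (a : ℕ) : Loc x M S :=
  LocalizedModule.mk y ((⟨∏ i ∈ S, x i, Submonoid.mem_powers _⟩ : pows x S) ^ a)

variable {x} {S T : Finset (Fin N)}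

theorem exists_frac (u : Loc x M S) : ∃ (y : M) (a : ℕ), u = frac x S y a := by
  induction u using LocalizedModule.induction_on with
  | h m s =>
    obtain ⟨_, a, rfl⟩ := s
    exact ⟨m, a, rfl⟩

theorem frac_eq_frac {y y' : M} {a a' : ℕ} : frac x S y a = frac x S y' a' ↔
    ∃ c : ℕ, (∏ i ∈ S, x i) ^ (a' + c) • y = (∏ i ∈ S, x i) ^ (a + c) • y' := by
  rw [frac, frac, LocalizedModule.mk_eq]
  constructor
  · rintro ⟨⟨_, c, rfl⟩, h⟩
    refine ⟨c, ?_⟩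
    simpa [Submonoid.smul_def, smul_smul, ← pow_add, add_comm] using h
  · rintro ⟨c, h⟩
    refine ⟨⟨_, c, rfl⟩, ?_⟩
    simpa [Submonoid.smul_def, smul_smul, ← pow_add, add_comm] using h

theorem frac_expand (y : M) (a b : ℕ) :
    frac x S ((∏ i ∈ S, x i) ^ b • y) (a + b) = frac x S y a :=
  frac_eq_frac.2 ⟨0, by rw [smul_smul, ← pow_add]; simp⟩

theorem frac_add (y y' : M) (a : ℕ) : frac x S y a + frac x S y' a = frac x S (y + y') a := by
  rw [frac, frac, LocalizedModule.mk_add_mk]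
  refine LocalizedModule.mk_eq.2 ⟨1, ?_⟩
  simp [Submonoid.smul_def, smul_smul]

theorem smul_frac (r : R) (y : M) (a : ℕ) : r • frac x S y a = frac x S (r • y) a :=
  LocalizedModule.smul'_mk _ _ _

@[simp] theorem frac_zero (a : ℕ) : frac x S (0 : M) a = 0 := LocalizedModule.zero_mk _

theorem frac_eq_zero {y : M} {a : ℕ} :
    frac x S y a = 0 ↔ ∃ c : ℕ, (∏ i ∈ S, x i) ^ c • y = 0 := by
  rw [← frac_zero (x := x) (S := S) (M := M) 0, frac_eq_frac]
  simp

theorem exists_frac₂ (u v : Loc x M S) :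
    ∃ (y z : M) (a : ℕ), u = frac x S y a ∧ v = frac x S z a := by
  obtain ⟨y, a, rfl⟩ := exists_frac u
  obtain ⟨z, b, rfl⟩ := exists_frac v
  refine ⟨_, (∏ i ∈ S, x i) ^ a • z, a + b, (frac_expand y a b).symm, ?_⟩
  rw [add_comm, frac_expand]

theorem eq_zero_of_pow_smul {u : Loc x M S} {c : ℕ} (h : (∏ i ∈ S, x i) ^ c • u = 0) :
    u = 0 := by
  obtain ⟨y, a, rfl⟩ := exists_frac u
  rw [smul_frac, frac_eq_zero] at h
  obtain ⟨b, hb⟩ := h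
  exact frac_eq_zero.2 ⟨b + c, by rw [pow_add, mul_smul, hb]⟩

theorem pow_smul_frac (y : M) (a : ℕ) :
    (∏ i ∈ S, x i) ^ a • frac x S y a = frac x S y 0 := by
  rw [smul_frac]
  simpa using frac_expand (x := x) (S := S) y 0 a

theorem res_frac (h : S ⊆ T) (y : M) (a : ℕ) :
    res x M h (frac x S y a) = frac x T ((∏ i ∈ T \ S, x i) ^ a • y) a := by
  have h0 : ∀ z : M, res x M h (frac x S z 0) = frac x T z 0 := by
    intro z
    simp [res, frac, LocalizedModule.mkLinearMap_apply]
  rw [← sub_eq_zero]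
  refine eq_zero_of_pow_smul (c := a) ?_
  rw [smul_sub, pow_smul_frac, ← Finset.prod_sdiff h, mul_pow, mul_smul, ← map_smul (res x M h),
    pow_smul_frac, h0, smul_frac, sub_self]

/-- M_{x_{S ∪ i}} is the localization of M_{x_S} at x_i. This lemma and `exists_res_eq` are the two
halves of that fact: kernel and image of the restriction, up to powers of x_i. -/
theorem res_eq_zero {i : Fin N} (hi : i ∉ S) {u : Loc x M S}
    (h : res x M (Finset.subset_insert i S) u = 0) : ∃ c : ℕ, x i ^ c • u = 0 := by
  obtain ⟨y, a, rfl⟩ := exists_frac u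
  rw [res_frac, frac_eq_zero] at h
  obtain ⟨c, hc⟩ := h
  refine ⟨c + a, ?_⟩
  rw [smul_frac, frac_eq_zero]
  refine ⟨c, ?_⟩
  rw [← hc, Finset.prod_insert hi, Finset.insert_sdiff_cancel hi, Finset.prod_singleton,
    smul_smul, smul_smul]
  ring_nf

theorem exists_res_eq {i : Fin N} (hi : i ∉ S) (v : Loc x M (insert i S)) :
    ∃ (c : ℕ) (u : Loc x M S), res x M (Finset.subset_insert i S) u = x i ^ c • v := by
  obtain ⟨y, a, rfl⟩ := exists_frac v
  refine ⟨a, frac x S y a, ?_⟩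
  rw [res_frac, Finset.insert_sdiff_cancel hi, Finset.prod_singleton, smul_frac]

/-- The map on localizations induced by a linear map. -/
def locMap (φ : L →ₗ[R] M) (S : Finset (Fin N)) : Loc x L S →ₗ[R] Loc x M S :=
  IsLocalizedModule.map (pows x S) (LocalizedModule.mkLinearMap (pows x S) L)
    (LocalizedModule.mkLinearMap (pows x S) M) φ

@[simp] theorem locMap_frac (φ : L →ₗ[R] M) (y : L) (a : ℕ) :
    locMap φ S (frac x S y a) = frac x S (φ y) a :=
  IsLocalizedModule.map_LocalizedModules _ _ _ _

theorem locMap_res (φ : L →ₗ[R] M) (h : S ⊆ T) (u : Loc x L S) :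
    locMap φ T (res x L h u) = res x M h (locMap φ S u) := by
  obtain ⟨y, a, rfl⟩ := exists_frac u
  simp [res_frac]

/-- The map of Čech complexes induced by a linear map. -/
def mapC (φ : L →ₗ[R] M) : Cochains x L →ₗ[R] Cochains x M :=
  LinearMap.pi fun S => (locMap φ S).comp (LinearMap.proj S)

@[simp] theorem mapC_apply (φ : L →ₗ[R] M) (c : Cochains x L) (S : Finset (Fin N)) :
    mapC φ c S = locMap φ S (c S) := rfl

theorem mapC_d (φ : L →ₗ[R] M) (c : Cochains x L) : mapC φ (d x L c) = d x M (mapC φ c) := by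
  funext T
  simp only [mapC_apply, d_apply, map_sum, map_smul, locMap_res]

theorem mapC_mem (φ : L →ₗ[R] M) {c : Cochains x L} {p : ℕ} (hc : c ∈ cochains x L p) :
    mapC φ c ∈ cochains x M p := fun S hS => by rw [mapC_apply, hc S hS, map_zero]

theorem d_mem {c : Cochains x M} {p : ℕ} (hc : c ∈ cochains x M p) :
    d x M c ∈ cochains x M (p + 1) := by
  intro T hT
  rw [d_apply]
  refine Finset.sum_eq_zero fun i hi => ?_
  rw [hc _ (fun h => hT ?_), map_zero, smul_zero]
  rw [← h, Finset.card_erase_add_one hi]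

/-- The cochains of degree `p - 1`. -/
def prevCochains (x : Fin N → R) (M : Type*) [AddCommGroup M] [Module R M] :
    ℕ → Submodule R (Cochains x M)
  | 0 => ⊥
  | q + 1 => cochains x M q

/-- Coboundaries are defined by cases on p; with `prevCochains` the cases p = 0 and p > 0 can be
treated together. -/
theorem mem_coboundaries {p : ℕ} {c : Cochains x M} :
    c ∈ coboundaries x M p ↔ ∃ b ∈ prevCochains x M p, d x M b = c := by
  cases p with
  | zero => simp [coboundaries, prevCochains, eq_comm]
  | succ q => simp [coboundaries, prevCochains]

theorem prevCochains_apply {p : ℕ} {b : Cochains x M} (hb : b ∈ prevCochains x M p)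
    {S : Finset (Fin N)} (hS : S.card + 1 ≠ p) : b S = 0 := by
  cases p with
  | zero => rw [(Submodule.mem_bot R).1 hb]; rfl
  | succ q => exact hb S (by omega)

theorem mem_prevCochains {p : ℕ} {b : Cochains x M}
    (hb : ∀ S : Finset (Fin N), S.card + 1 ≠ p → b S = 0) : b ∈ prevCochains x M p := by
  cases p with
  | zero => exact (Submodule.mem_bot R).2 (funext fun S => hb S (by omega))
  | succ q => exact fun S hS => hb S (by omega)

theorem d_mem_of_prev {b : Cochains x M} {p : ℕ} (hb : b ∈ prevCochains x M p) :
    d x M b ∈ cochains x M p := by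
  cases p with
  | zero => rw [(Submodule.mem_bot R).1 hb, map_zero]; exact zero_mem _
  | succ q => exact d_mem hb

/-- A cocycle becomes a coboundary after multiplication by a power of any `x_i`. -/
theorem exists_pow_smul_mem_coboundaries {p : ℕ} {z : Cochains x M} (hz : z ∈ cocycles x M p)
    (i : Fin N) : ∃ a : ℕ, x i ^ a • z ∈ coboundaries x M p := by
  classical
  obtain ⟨hzp, hdz⟩ := hz
  replace hdz : d x M z = 0 := hdz
  -- The plan is the contracting homotopy of the Čech complex in the direction i: up to sign, b_S is
  -- z_{S ∪ i} for i ∉ S, once a power of x_i has cleared x_i from the denominator. The exponent m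
  -- below serves all S at once.
  have lift : ∀ S : Finset (Fin N), ∃ c : ℕ, i ∉ S → S.card + 1 = p → ∃ u : Loc x M S,
      res x M (Finset.subset_insert i S) u = x i ^ c • z (insert i S) := by
    intro S
    by_cases hi : i ∈ S
    · exact ⟨0, fun h => absurd hi h⟩
    · obtain ⟨c, u, h⟩ := exists_res_eq hi (z (insert i S))
      exact ⟨c, fun _ _ => ⟨u, h⟩⟩
  choose c hc using lift
  set m := Finset.univ.sup c
  have lift' : ∀ S : Finset (Fin N), ∃ u : Loc x M S, ((i ∈ S ∨ S.card + 1 ≠ p) → u = 0) ∧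
      (i ∉ S → S.card + 1 = p →
        res x M (Finset.subset_insert i S) u = x i ^ m • z (insert i S)) := by
    intro S
    by_cases hS : i ∉ S ∧ S.card + 1 = p
    · obtain ⟨u, hu⟩ := hc S hS.1 hS.2
      refine ⟨x i ^ (m - c S) • u, fun h => ?_, fun _ _ => ?_⟩
      · rcases h with h | h
        · exact absurd h hS.1
        · exact absurd hS.2 h
      · rw [map_smul, hu, smul_smul, ← pow_add,
          Nat.sub_add_cancel (Finset.le_sup (Finset.mem_univ S))]
    · refine ⟨0, fun _ => rfl, fun h h' => absurd ⟨h, h'⟩ hS⟩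
  choose v hv0 hv using lift'
  let b : Cochains x M := fun S =>
    ((-1 : R) ^ ((insert i S).filter (· < i)).card) • v S
  have hb : b ∈ prevCochains x M p :=
    mem_prevCochains fun S hS => by simp only [b]; rw [hv0 S (Or.inr hS), smul_zero]
  have hb0 : ∀ S, i ∈ S → b S = 0 := fun S hS => by
    simp only [b]; rw [hv0 S (Or.inl hS), smul_zero]
  have key : ∀ (e : Cochains x M) (T : Finset (Fin N)) (hi : i ∈ T),
      (∀ S, i ∈ S → e S = 0) → d x M e T = ((-1 : R) ^ (T.filter (· < i)).card) •
        res x M (T.erase_subset i) (e (T.erase i)) := by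
    intro e T hi he
    rw [d_apply]
    refine Finset.sum_eq_single_of_mem i hi fun j hj hji => ?_
    rw [he _ (Finset.mem_erase.2 ⟨Ne.symm hji, hi⟩), map_zero, smul_zero]
  have hsq : ∀ k : ℕ, ((-1 : R) ^ k) * (-1) ^ k = 1 := fun k => by
    rw [← mul_pow]; simp
  have resInsert : ∀ (S T : Finset (Fin N)) (hST : insert i S = T) (h : S ⊆ T),
      i ∉ S → S.card + 1 = p → res x M h (v S) = x i ^ m • z T := by
    rintro S _ rfl h hi hS
    exact hv S hi hS
  -- The error w is a cocycle whose components at every T containing i vanish. Therefore (dw)_{T ∪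
  -- i} is, up to sign, the restriction of w_T, so a power of x_i kills w_T.
  let w : Cochains x M := d x M b - x i ^ m • z
  have hw : ∀ T, i ∈ T → w T = 0 := by
    intro T hi
    by_cases hT : T.card = p
    · have hcard : (T.erase i).card + 1 = p := by rw [Finset.card_erase_add_one hi, hT]
      have : d x M b T = x i ^ m • z T := by
        rw [key b T hi hb0]
        simp only [b]
        rw [map_smul, smul_smul, Finset.insert_erase hi, hsq, one_smul,
          resInsert _ _ (Finset.insert_erase hi) _ (Finset.notMem_erase i T) hcard]
      simp [w, this]
    · simp only [w, Pi.sub_apply, Pi.smul_apply]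
      rw [d_mem_of_prev hb T hT, hzp T hT, smul_zero, sub_zero]
  have hdw : d x M w = 0 := by simp [w, d_d, hdz]
  have hkill : ∀ T, ∃ k : ℕ, x i ^ k • w T = 0 := by
    intro T
    by_cases hi : i ∈ T
    · exact ⟨0, by rw [hw T hi, smul_zero]⟩
    · have h1 := congrFun hdw (insert i T)
      rw [key w _ (Finset.mem_insert_self i T) hw] at h1
      have h2 := congrArg (fun u => ((-1 : R) ^ ((insert i T).filter (· < i)).card) • u) h1
      simp only [smul_smul, hsq, one_smul, Pi.zero_apply, smul_zero] at h2
      have aux : ∀ (S : Finset (Fin N)) (hS : S = T) (h : S ⊆ insert i T),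
          res x M h (w S) = 0 → res x M (Finset.subset_insert i T) (w T) = 0 := by
        rintro _ rfl h h'; exact h'
      exact res_eq_zero hi (aux _ (Finset.erase_insert hi) _ h2)
  choose k hk using hkill
  refine ⟨Finset.univ.sup k + m, mem_coboundaries.2 ⟨x i ^ (Finset.univ.sup k) • b,
    Submodule.smul_mem _ _ hb, ?_⟩⟩
  have : x i ^ (Finset.univ.sup k) • w = 0 := by
    funext T
    rw [Pi.smul_apply, ← Nat.sub_add_cancel (Finset.le_sup (f := k) (Finset.mem_univ T)), pow_add,
      mul_smul, hk, smul_zero]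
    rfl
  simp only [w, smul_sub, sub_eq_zero] at this
  rw [map_smul, this, smul_smul, pow_add]

/-- Any element of an ideal in the radical of `(x)` has a power that kills a given class. -/
theorem exists_pow_smul_mem_coboundaries_of_mem {p : ℕ} {z : Cochains x M}
    (hz : z ∈ cocycles x M p) {f : R} (hf : f ∈ Ideal.span (Set.range x)) :
    ∃ a : ℕ, f ^ a • z ∈ coboundaries x M p := by
  -- The multipliers that turn z into a coboundary form an ideal, whose radical contains every x_i.
  let I : Ideal R := (coboundaries x M p).comap (LinearMap.toSpanSingleton R _ z)
  have hle : Ideal.span (Set.range x) ≤ I.radical := by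
    rw [Ideal.span_le]
    rintro _ ⟨i, rfl⟩
    obtain ⟨a, ha⟩ := exists_pow_smul_mem_coboundaries hz i
    exact ⟨a, by simpa [I] using ha⟩
  obtain ⟨a, ha⟩ := hle hf
  exact ⟨a, by simpa [I] using ha⟩

end Fractions

end Cech
end

noncomputable section
/-! ### Degrees in the Čech complex -/

namespace Cech

/-- A grading of an additive group by `ℤ`, given by the projections to its pieces. -/
structure Grading {M : Type*} [AddCommGroup M] (ℳ : ℤ → AddSubgroup M) where
  /-- the projection to the piece of degree `e` -/
  proj : ℤ → M →+ M
  proj_mem : ∀ e m, proj e m ∈ ℳ e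
  proj_self : ∀ {e m}, m ∈ ℳ e → proj e m = m
  proj_ne : ∀ {e e' m}, m ∈ ℳ e → e ≠ e' → proj e' m = 0
  exists_sum : ∀ m, ∃ s : Finset ℤ, m = ∑ e ∈ s, proj e m

/-- Multiplication by `r` raises degrees by `d`. -/
def SMulDeg {R M : Type*} [CommRing R] [AddCommGroup M] [Module R M] (ℳ : ℤ → AddSubgroup M)
    (r : R) (d : ℤ) : Prop :=
  ∀ ⦃e m⦄, m ∈ ℳ e → r • m ∈ ℳ (e + d)

section Degrees

variable {R : Type*} [CommRing R] {N : ℕ} {x : Fin N → R}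
  {L M P : Type*} [AddCommGroup L] [Module R L] [AddCommGroup M] [Module R M]
  [AddCommGroup P] [Module R P] {ℒ : ℤ → AddSubgroup L} {ℳ : ℤ → AddSubgroup M}
  {𝒬 : ℤ → AddSubgroup P} {S T : Finset (Fin N)}

theorem SMulDeg.one : SMulDeg (R := R) ℳ 1 0 := fun e m h => by simpa using h

theorem SMulDeg.mul {r s : R} {d d' : ℤ} (hr : SMulDeg ℳ r d) (hs : SMulDeg ℳ s d') :
    SMulDeg ℳ (r * s) (d + d') := fun e m h => by
  rw [mul_smul, add_comm d, ← add_assoc]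
  exact hr (hs h)

theorem SMulDeg.pow {r : R} {d : ℤ} (hr : SMulDeg ℳ r d) (a : ℕ) :
    SMulDeg ℳ (r ^ a) (a * d) := by
  induction a with
  | zero => simpa using SMulDeg.one
  | succ a ih =>
    rw [pow_succ]
    have := ih.mul hr
    rwa [show (a : ℤ) * d + d = ((a + 1 : ℕ) : ℤ) * d by push_cast; ring] at this

theorem SMulDeg.prod (hx : ∀ i, SMulDeg ℳ (x i) 1) (S : Finset (Fin N)) :
    SMulDeg ℳ (∏ i ∈ S, x i) S.card := by
  classical
  induction S using Finset.induction_on with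
  | empty => simpa using SMulDeg.one
  | insert i S hi ih =>
    rw [Finset.prod_insert hi, Finset.card_insert_of_notMem hi]
    have := (hx i).mul ih
    rwa [show (1 : ℤ) + S.card = ((S.card + 1 : ℕ) : ℤ) by push_cast; ring] at this

theorem Grading.proj_smul (g : Grading ℳ) {r : R} {d : ℤ} (hr : SMulDeg ℳ r d) (e : ℤ) (m : M) :
    g.proj (e + d) (r • m) = r • g.proj e m := by
  obtain ⟨s, hs⟩ := g.exists_sum m
  conv_lhs => rw [hs]
  conv_rhs => rw [hs]
  rw [Finset.smul_sum, map_sum, map_sum, Finset.smul_sum]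
  refine Finset.sum_congr rfl fun e' _ => ?_
  by_cases h : e' = e
  · subst h
    rw [g.proj_self (hr (g.proj_mem _ _)), g.proj_self (g.proj_mem _ _)]
  · rw [g.proj_ne (hr (g.proj_mem _ _)) (fun h' => h (by omega)), g.proj_ne (g.proj_mem _ _) h,
      smul_zero]

theorem mem_locDeg_frac {y : M} {a : ℕ} {e : ℤ} (hy : y ∈ ℳ (e + a * S.card)) :
    frac x S y a ∈ locDeg x ℳ S e := ⟨a, y, hy, rfl⟩

theorem mem_locDeg {u : Loc x M S} {e : ℤ} : u ∈ locDeg x ℳ S e ↔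
    ∃ (y : M) (a : ℕ), y ∈ ℳ (e + a * S.card) ∧ u = frac x S y a :=
  ⟨fun ⟨a, y, h, h'⟩ => ⟨y, a, h, h'⟩, fun ⟨y, a, h, h'⟩ => ⟨a, y, h, h'⟩⟩

theorem locDeg_zero {e : ℤ} : (0 : Loc x M S) ∈ locDeg x ℳ S e := by
  rw [← frac_zero (x := x) (S := S) (M := M) 0]
  exact mem_locDeg_frac (zero_mem _)

theorem locDeg_smul {r : R} {d : ℤ} (hr : SMulDeg ℳ r d) {e : ℤ} {u : Loc x M S}
    (hu : u ∈ locDeg x ℳ S e) : r • u ∈ locDeg x ℳ S (e + d) := by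
  obtain ⟨y, a, hy, rfl⟩ := mem_locDeg.1 hu
  rw [smul_frac]
  refine mem_locDeg_frac ?_
  rw [add_right_comm]
  exact hr hy

theorem pow_smul_mem (hx : ∀ i, SMulDeg ℳ (x i) 1) {y : M} {e : ℤ} {a : ℕ}
    (hy : y ∈ ℳ (e + a * S.card)) (b : ℕ) :
    (∏ i ∈ S, x i) ^ b • y ∈ ℳ (e + (a + b : ℕ) * S.card) := by
  have := ((SMulDeg.prod hx S).pow b) hy
  rwa [show e + a * S.card + b * (S.card : ℤ) = e + (a + b : ℕ) * S.card by
    push_cast; ring] at this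

theorem locDeg_add (hx : ∀ i, SMulDeg ℳ (x i) 1) {e : ℤ} {u v : Loc x M S}
    (hu : u ∈ locDeg x ℳ S e) (hv : v ∈ locDeg x ℳ S e) : u + v ∈ locDeg x ℳ S e := by
  obtain ⟨y, a, hy, rfl⟩ := mem_locDeg.1 hu
  obtain ⟨z, b, hz, rfl⟩ := mem_locDeg.1 hv
  rw [← frac_expand y a b, ← frac_expand z b a, add_comm b a, frac_add]
  refine mem_locDeg_frac (add_mem (pow_smul_mem hx hy b) ?_)
  rw [add_comm a b]
  exact pow_smul_mem hx hz a

variable (x ℳ) in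
/-- The elements of degree `e` of `M_{x_S}`, as a subgroup. -/
def locDegSubgroup (hx : ∀ i, SMulDeg ℳ (x i) 1) (S : Finset (Fin N)) (e : ℤ) :
    AddSubgroup (Loc x M S) where
  carrier := locDeg x ℳ S e
  add_mem' := locDeg_add hx
  zero_mem' := locDeg_zero
  neg_mem' := by
    intro u hu
    obtain ⟨y, a, hy, rfl⟩ := mem_locDeg.1 hu
    rw [← neg_one_smul R, smul_frac, neg_one_smul]
    exact mem_locDeg_frac (neg_mem hy)

variable (x ℳ) in
/-- The cochains of degree `e`. -/
def degCochains (hx : ∀ i, SMulDeg ℳ (x i) 1) (e : ℤ) : AddSubgroup (Cochains x M) :=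
  AddSubgroup.pi Set.univ fun S => locDegSubgroup x ℳ hx S e

theorem mem_degCochains {hx : ∀ i, SMulDeg ℳ (x i) 1} {e : ℤ} {c : Cochains x M} :
    c ∈ degCochains x ℳ hx e ↔ ∀ S, c S ∈ locDeg x ℳ S e := by
  simp [degCochains, AddSubgroup.mem_pi]; rfl

theorem locDeg_res (hx : ∀ i, SMulDeg ℳ (x i) 1) (h : S ⊆ T) {e : ℤ} {u : Loc x M S}
    (hu : u ∈ locDeg x ℳ S e) : res x M h u ∈ locDeg x ℳ T e := by
  obtain ⟨y, a, hy, rfl⟩ := mem_locDeg.1 hu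
  rw [res_frac]
  refine mem_locDeg_frac ?_
  have := ((SMulDeg.prod hx (T \ S)).pow a) hy
  rwa [show e + a * S.card + a * ((T \ S).card : ℤ) = e + a * T.card by
    rw [← Finset.card_sdiff_add_card_eq_card h]; push_cast; ring] at this

theorem d_mem_degCochains {hx : ∀ i, SMulDeg ℳ (x i) 1} {e : ℤ} {c : Cochains x M}
    (hc : c ∈ degCochains x ℳ hx e) : d x M c ∈ degCochains x ℳ hx e := by
  rw [mem_degCochains] at hc ⊢
  intro T
  rw [d_apply]
  refine (locDegSubgroup x ℳ hx T e).sum_mem fun i _ => ?_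
  rcases neg_one_pow_eq_or R (T.filter (· < i)).card with h | h
  · rw [h, one_smul]; exact locDeg_res hx _ (hc _)
  · rw [h, neg_one_smul]; exact (locDegSubgroup x ℳ hx T e).neg_mem (locDeg_res hx _ (hc _))

/-! #### Projections to the graded pieces -/

/-- Clearing denominators gives an equation in M, and its component of degree e + (a + a' + c)·#S is
the claim. This makes `locProj` independent of the chosen fraction. -/
theorem frac_proj_eq (g : Grading ℳ) (hx : ∀ i, SMulDeg ℳ (x i) 1) {y y' : M} {a a' : ℕ}
    (h : frac x S y a = frac x S y' a') (e : ℤ) :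
    frac x S (g.proj (e + a * S.card) y) a = frac x S (g.proj (e + a' * S.card) y') a' := by
  obtain ⟨c, hc⟩ := frac_eq_frac.1 h
  refine frac_eq_frac.2 ⟨c, ?_⟩
  have h1 := congrArg (g.proj (e + (a + a' + c : ℕ) * S.card)) hc
  have hp := SMulDeg.prod hx S
  have e1 : e + (a + a' + c : ℕ) * (S.card : ℤ) =
      e + a * S.card + (a' + c : ℕ) * (S.card : ℤ) := by push_cast; ring
  have e2 : e + (a + a' + c : ℕ) * (S.card : ℤ) =
      e + a' * S.card + (a + c : ℕ) * (S.card : ℤ) := by push_cast; ring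
  conv_lhs at h1 => rw [e1]
  conv_rhs at h1 => rw [e2]
  rwa [g.proj_smul (hp.pow _), g.proj_smul (hp.pow _)] at h1

/-- The projection of `M_{x_S}` to its piece of degree `e`. -/
def locProj (g : Grading ℳ) (S : Finset (Fin N)) (e : ℤ) (u : Loc x M S) : Loc x M S :=
  frac x S (g.proj (e + (exists_frac u).choose_spec.choose * S.card) (exists_frac u).choose)
    (exists_frac u).choose_spec.choose

theorem locProj_frac (g : Grading ℳ) (hx : ∀ i, SMulDeg ℳ (x i) 1) (e : ℤ) (y : M) (a : ℕ) :
    locProj g S e (frac x S y a) = frac x S (g.proj (e + a * S.card) y) a :=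
  frac_proj_eq g hx (exists_frac (frac x S y a)).choose_spec.choose_spec.symm e

theorem locProj_mem (g : Grading ℳ) (e : ℤ) (u : Loc x M S) :
    locProj g S e u ∈ locDeg x ℳ S e :=
  mem_locDeg_frac (g.proj_mem _ _)

theorem locProj_self (g : Grading ℳ) (hx : ∀ i, SMulDeg ℳ (x i) 1) {e : ℤ} {u : Loc x M S}
    (hu : u ∈ locDeg x ℳ S e) : locProj g S e u = u := by
  obtain ⟨y, a, hy, rfl⟩ := mem_locDeg.1 hu
  rw [locProj_frac g hx, g.proj_self hy]

theorem locProj_zero (g : Grading ℳ) (hx : ∀ i, SMulDeg ℳ (x i) 1) (e : ℤ) :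
    locProj g S e (0 : Loc x M S) = 0 := locProj_self g hx locDeg_zero

theorem locProj_add (g : Grading ℳ) (hx : ∀ i, SMulDeg ℳ (x i) 1) (e : ℤ) (u v : Loc x M S) :
    locProj g S e (u + v) = locProj g S e u + locProj g S e v := by
  obtain ⟨y, z, a, rfl, rfl⟩ := exists_frac₂ u v
  rw [frac_add]
  simp only [locProj_frac g hx, map_add, frac_add]

variable (x) in
/-- The projection of the cochains to their piece of degree `e`. -/
def projC (g : Grading ℳ) (hx : ∀ i, SMulDeg ℳ (x i) 1) (e : ℤ) :
    Cochains x M →+ Cochains x M where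
  toFun c S := locProj g S e (c S)
  map_zero' := funext fun _ => locProj_zero g hx e
  map_add' _ _ := funext fun _ => locProj_add g hx e _ _

theorem locProj_res (g : Grading ℳ) (hx : ∀ i, SMulDeg ℳ (x i) 1) (e : ℤ) (h : S ⊆ T)
    (u : Loc x M S) : locProj g T e (res x M h u) = res x M h (locProj g S e u) := by
  obtain ⟨y, a, rfl⟩ := exists_frac u
  rw [res_frac, locProj_frac g hx, locProj_frac g hx, res_frac,
    ← g.proj_smul ((SMulDeg.prod hx (T \ S)).pow a),
    show e + a * S.card + a * ((T \ S).card : ℤ) = e + a * T.card by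
      rw [← Finset.card_sdiff_add_card_eq_card h]; push_cast; ring]

theorem projC_d (g : Grading ℳ) (hx : ∀ i, SMulDeg ℳ (x i) 1) (e : ℤ) (c : Cochains x M) :
    projC x g hx e (d x M c) = d x M (projC x g hx e c) := by
  funext T
  let q : Loc x M T →+ Loc x M T := ⟨⟨locProj g T e, locProj_zero g hx e⟩, locProj_add g hx e⟩
  change q (d x M c T) = _
  rw [d_apply, d_apply, map_sum]
  refine Finset.sum_congr rfl fun i _ => ?_
  have hq : ∀ u, q (res x M (T.erase_subset i) u) =
    res x M (T.erase_subset i) (locProj g (T.erase i) e u) := locProj_res g hx e _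
  rcases neg_one_pow_eq_or R (T.filter (· < i)).card with h | h
  · rw [h, one_smul, one_smul, hq]; rfl
  · rw [h, neg_one_smul, neg_one_smul, map_neg, hq]; rfl

/-- A homogeneous coboundary is the coboundary of a cochain of the same degree. -/
theorem exists_homogeneous_of_mem_coboundaries (g : Grading ℳ) (hx : ∀ i, SMulDeg ℳ (x i) 1)
    {p : ℕ} {e : ℤ} {c : Cochains x M} (hc : c ∈ coboundaries x M p)
    (hce : c ∈ degCochains x ℳ hx e) :
    ∃ b ∈ prevCochains x M p, b ∈ degCochains x ℳ hx e ∧ d x M b = c := by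
  obtain ⟨b, hb, rfl⟩ := mem_coboundaries.1 hc
  -- The projection commutes with d, so the degree e part of any primitive is again a primitive.
  refine ⟨projC x g hx e b, mem_prevCochains fun S hS => ?_,
    mem_degCochains.2 fun S => locProj_mem g e _, ?_⟩
  · change locProj g S e (b S) = 0
    rw [prevCochains_apply hb hS, locProj_zero g hx]
  · rw [← projC_d]
    exact funext fun S => locProj_self g hx (mem_degCochains.1 hce S)

variable (x ℳ) in
/-- `H^p_{(x)}(M)_e = 0`. -/
def Vanishes (p : ℕ) (e : ℤ) : Prop :=
  ∀ c ∈ cocycles x M p, (∀ S, c S ∈ locDeg x ℳ S e) → c ∈ coboundaries x M p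

/-- Links the cochain-level condition, with which all later arguments work, to the condition under
the supremum in `endH`. -/
theorem vanishes_iff {p : ℕ} {e : ℤ} : Vanishes x ℳ p e ↔ ¬ ∃ h ∈ HDeg x ℳ p e, h ≠ 0 := by
  constructor
  · rintro H ⟨_, ⟨z, hz, rfl⟩, hne⟩
    refine hne ((Submodule.Quotient.mk_eq_zero _).2 ?_)
    exact H z.1 z.2 hz
  · intro H c hc hce
    by_contra hcb
    exact H ⟨_, ⟨⟨c, hc⟩, hce, rfl⟩, fun h => hcb (Submodule.mem_comap.1 ((Submodule.Quotient.mk_eq_zero _).1 h))⟩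

/-! #### Short exact sequences -/

/-- An exact sequence `0 → L(-d) → M → P → 0` of graded modules. -/
structure ShortExact (ℒ : ℤ → AddSubgroup L) (ℳ : ℤ → AddSubgroup M) (𝒬 : ℤ → AddSubgroup P)
    (d : ℤ) (φ : L →ₗ[R] M) (ψ : M →ₗ[R] P) : Prop where
  inj : Function.Injective φ
  exact : ∀ m, ψ m = 0 → ∃ l, φ l = m
  comp : ∀ l, ψ (φ l) = 0
  mem_iff : ∀ {e l}, φ l ∈ ℳ (e + d) ↔ l ∈ ℒ e
  map_mem : ∀ {e m}, m ∈ ℳ e → ψ m ∈ 𝒬 e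
  lift : ∀ {e y}, y ∈ 𝒬 e → ∃ m ∈ ℳ e, ψ m = y

namespace ShortExact

variable {δ : ℤ} {φ : L →ₗ[R] M} {ψ : M →ₗ[R] P} (H : ShortExact ℒ ℳ 𝒬 δ φ ψ)
include H

theorem smulDeg_left {r : R} {d : ℤ} (h : SMulDeg ℳ r d) : SMulDeg ℒ r d := fun e l hl => by
  rw [← H.mem_iff, map_smul, add_right_comm]
  exact h (H.mem_iff.2 hl)

theorem smulDeg_right {r : R} {d : ℤ} (h : SMulDeg ℳ r d) : SMulDeg 𝒬 r d := fun e l hl => by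
  obtain ⟨m, hm, rfl⟩ := H.lift hl
  rw [← map_smul]
  exact H.map_mem (h hm)

theorem locMap_injective : Function.Injective (locMap (x := x) φ S) := by
  rw [injective_iff_map_eq_zero]
  intro u hu
  obtain ⟨y, a, rfl⟩ := exists_frac u
  rw [locMap_frac, frac_eq_zero] at hu
  obtain ⟨c, hc⟩ := hu
  rw [← map_smul, ← map_zero φ] at hc
  exact frac_eq_zero.2 ⟨c, H.inj hc⟩

theorem mapC_injective : Function.Injective (mapC (x := x) φ) := fun _ _ h =>
  funext fun S => H.locMap_injective (congrFun h S)

theorem mapC_mapC (c : Cochains x L) : mapC ψ (mapC φ c) = 0 := by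
  funext S
  obtain ⟨y, a, h⟩ := exists_frac (c S)
  simp [h, H.comp]

theorem mapC_left_mem {hL : ∀ i, SMulDeg ℒ (x i) 1} {hM : ∀ i, SMulDeg ℳ (x i) 1} {e : ℤ}
    {c : Cochains x L} (hc : c ∈ degCochains x ℒ hL e) :
    mapC φ c ∈ degCochains x ℳ hM (e + δ) := by
  rw [mem_degCochains] at hc ⊢
  intro S
  obtain ⟨y, a, hy, h⟩ := mem_locDeg.1 (hc S)
  rw [mapC_apply, h, locMap_frac]
  refine mem_locDeg_frac ?_
  rw [add_right_comm]
  exact H.mem_iff.2 hy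

theorem mapC_right_mem {hM : ∀ i, SMulDeg ℳ (x i) 1} {hP : ∀ i, SMulDeg 𝒬 (x i) 1} {e : ℤ}
    {c : Cochains x M} (hc : c ∈ degCochains x ℳ hM e) :
    mapC ψ c ∈ degCochains x 𝒬 hP e := by
  rw [mem_degCochains] at hc ⊢
  intro S
  obtain ⟨y, a, hy, h⟩ := mem_locDeg.1 (hc S)
  rw [mapC_apply, h, locMap_frac]
  exact mem_locDeg_frac (H.map_mem hy)

/-- Localization is exact, in each degree separately. -/
theorem exists_left {hL : ∀ i, SMulDeg ℒ (x i) 1} {hM : ∀ i, SMulDeg ℳ (x i) 1} {e : ℤ}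
    {c : Cochains x M} (hc : c ∈ degCochains x ℳ hM (e + δ)) (h0 : mapC ψ c = 0) :
    ∃ u ∈ degCochains x ℒ hL e, mapC φ u = c := by
  rw [mem_degCochains] at hc
  have : ∀ S, ∃ u ∈ locDeg x ℒ S e, locMap φ S u = c S := by
    intro S
    obtain ⟨y, a, hy, h⟩ := mem_locDeg.1 (hc S)
    have h1 := congrFun h0 S
    rw [mapC_apply, h, locMap_frac] at h1
    obtain ⟨k, hk⟩ := frac_eq_zero.1 h1
    rw [← map_smul] at hk
    obtain ⟨l, hl⟩ := H.exact _ hk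
    -- Only x_S^k y is known to lie in the kernel of ψ, hence the expanded denominator.
    refine ⟨frac x S l (a + k), mem_locDeg_frac (H.mem_iff.1 ?_), ?_⟩
    · rw [hl, add_right_comm]
      exact pow_smul_mem hM hy k
    · rw [locMap_frac, hl, frac_expand, h]
  choose u hu hu' using this
  exact ⟨u, mem_degCochains.2 hu, funext hu'⟩

/-- The last clause keeps the support of the cochain, so the lift stays in the same `cochains` or
`prevCochains`. -/
theorem exists_right {hM : ∀ i, SMulDeg ℳ (x i) 1} {hP : ∀ i, SMulDeg 𝒬 (x i) 1} {e : ℤ}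
    {c : Cochains x P} (hc : c ∈ degCochains x 𝒬 hP e) :
    ∃ b ∈ degCochains x ℳ hM e, mapC ψ b = c ∧ ∀ S, c S = 0 → b S = 0 := by
  rw [mem_degCochains] at hc
  have : ∀ S, ∃ u ∈ locDeg x ℳ S e, locMap ψ S u = c S ∧ (c S = 0 → u = 0) := by
    intro S
    by_cases h0 : c S = 0
    · exact ⟨0, locDeg_zero, by rw [map_zero, h0], fun _ => rfl⟩
    obtain ⟨y, a, hy, h⟩ := mem_locDeg.1 (hc S)
    obtain ⟨m, hm, rfl⟩ := H.lift hy
    exact ⟨frac x S m a, mem_locDeg_frac hm, by rw [locMap_frac, h], fun h' => absurd h' h0⟩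
  choose u hu hu' h0 using this
  exact ⟨u, mem_degCochains.2 hu, funext hu', h0⟩

theorem mem_cochains_left {p : ℕ} {u : Cochains x L} (hu : mapC φ u ∈ cochains x M p) :
    u ∈ cochains x L p := fun S hS => by
  apply H.locMap_injective
  rw [map_zero]
  exact hu S hS

omit H in
theorem mapC_mem_prev (φ : L →ₗ[R] M) {p : ℕ} {u : Cochains x L} (hu : u ∈ prevCochains x L p) :
    mapC φ u ∈ prevCochains x M p :=
  mem_prevCochains fun S hS => by rw [mapC_apply, prevCochains_apply hu hS, map_zero]

/-- Exactness of H^p(L)_e → H^p(M)_{e+δ} → H^p(P)_{e+δ} at the middle term, by a diagram chase.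
Homogeneous primitives keep the chase inside one degree. -/
theorem vanishes_mid (gP : Grading 𝒬) (hM : ∀ i, SMulDeg ℳ (x i) 1) {p : ℕ}
    {e : ℤ} (hVL : Vanishes x ℒ p e) (hVP : Vanishes x 𝒬 p (e + δ)) :
    Vanishes x ℳ p (e + δ) := by
  have hL : ∀ i, SMulDeg ℒ (x i) 1 := fun i => H.smulDeg_left (hM i)
  have hP : ∀ i, SMulDeg 𝒬 (x i) 1 := fun i => H.smulDeg_right (hM i)
  rintro c ⟨hcp, hdc⟩ hce
  replace hdc : d x M c = 0 := hdc
  replace hce : c ∈ degCochains x ℳ hM (e + δ) := mem_degCochains.2 hce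
  have hψ : mapC ψ c ∈ degCochains x 𝒬 hP (e + δ) := H.mapC_right_mem hce
  have h1 := hVP (mapC ψ c) ⟨mapC_mem ψ hcp, by
    change d x P _ = 0; rw [← mapC_d, hdc, map_zero]⟩ (mem_degCochains.1 hψ)
  obtain ⟨b, hb, hbe, hdb⟩ := exists_homogeneous_of_mem_coboundaries gP hP h1 hψ
  obtain ⟨b', hb'e, hb', hb'0⟩ := H.exists_right (hM := hM) hbe
  have hb'p : b' ∈ prevCochains x M p :=
    mem_prevCochains fun S hS => hb'0 S (prevCochains_apply hb hS)
  obtain ⟨u, hue, hu⟩ := H.exists_left (hL := hL) (sub_mem hce (d_mem_degCochains hb'e))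
    (by rw [map_sub, mapC_d, hb', hdb, sub_self])
  have hup : u ∈ cochains x L p :=
    H.mem_cochains_left (by rw [hu]; exact sub_mem hcp (d_mem_of_prev hb'p))
  have hdu : d x L u = 0 := H.mapC_injective (by
    rw [mapC_d, hu, map_sub, hdc, d_d, sub_self, map_zero])
  obtain ⟨v, hv, hdv⟩ := mem_coboundaries.1 (hVL u ⟨hup, hdu⟩ (mem_degCochains.1 hue))
  refine mem_coboundaries.2 ⟨b' + mapC φ v, add_mem hb'p (mapC_mem_prev φ hv), ?_⟩
  rw [map_add, ← mapC_d, hdv, hu, add_sub_cancel]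

/-- Exactness of H^p(M)_{e+δ} → H^p(P)_{e+δ} → H^{p+1}(L)_e; the cocycle u below represents the
connecting image of c. -/
theorem vanishes_right (gL : Grading ℒ) (hM : ∀ i, SMulDeg ℳ (x i) 1) {p : ℕ}
    {e : ℤ} (hVM : Vanishes x ℳ p (e + δ)) (hVL : Vanishes x ℒ (p + 1) e) :
    Vanishes x 𝒬 p (e + δ) := by
  have hL : ∀ i, SMulDeg ℒ (x i) 1 := fun i => H.smulDeg_left (hM i)
  have hP : ∀ i, SMulDeg 𝒬 (x i) 1 := fun i => H.smulDeg_right (hM i)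
  rintro c ⟨hcp, hdc⟩ hce
  replace hdc : d x P c = 0 := hdc
  replace hce : c ∈ degCochains x 𝒬 hP (e + δ) := mem_degCochains.2 hce
  obtain ⟨b, hbe, hb, hb0⟩ := H.exists_right (hM := hM) hce
  have hbp : b ∈ cochains x M p := fun S hS => hb0 S (hcp S hS)
  obtain ⟨u, hue, hu⟩ := H.exists_left (hL := hL) (d_mem_degCochains hbe)
    (by rw [mapC_d, hb, hdc])
  have hup : u ∈ cochains x L (p + 1) := H.mem_cochains_left (by rw [hu]; exact d_mem hbp)
  have hdu : d x L u = 0 := H.mapC_injective (by rw [mapC_d, hu, d_d, map_zero])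
  have h1 := hVL u ⟨hup, hdu⟩ (mem_degCochains.1 hue)
  obtain ⟨v, hv, hve, hdv⟩ := exists_homogeneous_of_mem_coboundaries gL hL h1 hue
  have h2 := hVM (b - mapC φ v) ⟨sub_mem hbp (mapC_mem φ hv), by
    change d x M _ = 0; rw [map_sub, ← mapC_d, hdv, hu, sub_self]⟩
    (mem_degCochains.1 (sub_mem hbe (H.mapC_left_mem hve)))
  obtain ⟨w, hw, hdw⟩ := mem_coboundaries.1 h2
  refine mem_coboundaries.2 ⟨mapC ψ w, mapC_mem_prev ψ hw, ?_⟩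
  rw [← mapC_d, hdw, map_sub, hb, H.mapC_mapC, sub_zero]

/-- Exactness of H^{p-1}(P)_{e+δ} → H^p(L)_e → H^p(M)_{e+δ}. It is stated for a single z because it
is applied where only φ(z) is known to be a coboundary. For p = 0 the condition on P is empty. -/
theorem mem_coboundaries_left (gM : Grading ℳ) (gP : Grading 𝒬) (hM : ∀ i, SMulDeg ℳ (x i) 1)
    {p : ℕ} {e : ℤ} (hVP : ∀ q, q + 1 = p → Vanishes x 𝒬 q (e + δ)) {z : Cochains x L}
    (hz : ∀ S, z S ∈ locDeg x ℒ S e) (hφ : mapC φ z ∈ coboundaries x M p) :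
    z ∈ coboundaries x L p := by
  have hL : ∀ i, SMulDeg ℒ (x i) 1 := fun i => H.smulDeg_left (hM i)
  have hP : ∀ i, SMulDeg 𝒬 (x i) 1 := fun i => H.smulDeg_right (hM i)
  replace hz : z ∈ degCochains x ℒ hL e := mem_degCochains.2 hz
  obtain ⟨b, hb, hbe, hdb⟩ :=
    exists_homogeneous_of_mem_coboundaries gM hM hφ (H.mapC_left_mem hz)
  cases p with
  | zero =>
    rw [(Submodule.mem_bot R).1 hb, map_zero] at hdb
    rw [H.mapC_injective (by rw [← hdb, map_zero] : mapC φ z = mapC φ 0)]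
    exact zero_mem _
  | succ q =>
    have hψ : mapC ψ b ∈ degCochains x 𝒬 hP (e + δ) := H.mapC_right_mem hbe
    have h1 := hVP q rfl (mapC ψ b) ⟨mapC_mem ψ hb, by
      change d x P _ = 0; rw [← mapC_d, hdb, H.mapC_mapC]⟩ (mem_degCochains.1 hψ)
    obtain ⟨w, hw, hwe, hdw⟩ := exists_homogeneous_of_mem_coboundaries gP hP h1 hψ
    obtain ⟨w', hw'e, hw', hw'0⟩ := H.exists_right (hM := hM) hwe
    have hw'p : w' ∈ prevCochains x M q :=
      mem_prevCochains fun S hS => hw'0 S (prevCochains_apply hw hS)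
    obtain ⟨u, hue, hu⟩ := H.exists_left (hL := hL) (sub_mem hbe (d_mem_degCochains hw'e))
      (by rw [map_sub, mapC_d, hw', hdw, sub_self])
    refine mem_coboundaries.2 ⟨u, H.mem_cochains_left (p := q) ?_, H.mapC_injective ?_⟩
    · rw [hu]; exact sub_mem hb (d_mem_of_prev hw'p)
    · rw [mapC_d, hu, map_sub, d_d, sub_zero, hdb]

end ShortExact

end Degrees

end Cech
end

noncomputable section
/-! ### Gradings of submodules and quotients -/

namespace Cech

section Gradings

variable {R : Type*} [CommRing R] {L M P : Type*} [AddCommGroup L] [Module R L]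
  [AddCommGroup M] [Module R M] [AddCommGroup P] {ℳ : ℤ → AddSubgroup M}

/-- The grading induced along an injective map whose range is homogeneous. -/
def Grading.comap (g : Grading ℳ) (ι : L →+ M) (hι : Function.Injective ι)
    (h : ∀ e l, ∃ l', ι l' = g.proj e (ι l)) : Grading fun e => (ℳ e).comap ι where
  proj e :=
    { toFun l := (h e l).choose
      map_zero' := hι (by rw [(h e 0).choose_spec, map_zero, map_zero])
      map_add' a b := hι (by
        rw [(h e (a + b)).choose_spec, map_add, map_add, map_add, (h e a).choose_spec,
          (h e b).choose_spec]) }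
  proj_mem e l := by
    change ι (h e l).choose ∈ ℳ e
    rw [(h e l).choose_spec]
    exact g.proj_mem _ _
  proj_self {e l} hl := hι ((h e l).choose_spec.trans (g.proj_self hl))
  proj_ne {e e' l} hl hne := hι ((h e' l).choose_spec.trans
    ((g.proj_ne hl hne).trans (map_zero ι).symm))
  exists_sum l := by
    obtain ⟨s, hs⟩ := g.exists_sum (ι l)
    refine ⟨s, hι ?_⟩
    rw [map_sum]
    refine hs.trans (Finset.sum_congr rfl fun e _ => ?_)
    exact (h e l).choose_spec.symm

/-- The grading induced along a surjective map whose kernel is homogeneous. -/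
def Grading.map (g : Grading ℳ) (ψ : M →+ P) (hψ : Function.Surjective ψ)
    (h : ∀ e m, ψ m = 0 → ψ (g.proj e m) = 0) : Grading fun e => (ℳ e).map ψ :=
  -- The projection does not depend on the lift chosen by `surjInv`, because the kernel is
  -- homogeneous.
  have key : ∀ e m, ψ (g.proj e (Function.surjInv hψ (ψ m))) = ψ (g.proj e m) := fun e m => by
    rw [← sub_eq_zero, ← map_sub, ← map_sub]
    exact h e _ (by rw [map_sub, Function.surjInv_eq hψ, sub_self])
  { proj := fun e =>
      { toFun := fun q => ψ (g.proj e (Function.surjInv hψ q))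
        map_zero' := by
          have := key e 0
          rwa [map_zero, map_zero, map_zero] at this
        map_add' := fun a b => by
          obtain ⟨a, rfl⟩ := hψ a
          obtain ⟨b, rfl⟩ := hψ b
          rw [← map_add, key, key, key, map_add, map_add] }
    proj_mem := fun e q => AddSubgroup.mem_map_of_mem _ (g.proj_mem _ _)
    proj_self := by
      rintro e _ ⟨m, hm, rfl⟩
      exact (key e m).trans (by rw [g.proj_self hm])
    proj_ne := by
      rintro e e' _ ⟨m, hm, rfl⟩ hne
      exact (key e' m).trans (by rw [g.proj_ne hm hne, map_zero])
    exists_sum := by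
      intro q
      obtain ⟨m, rfl⟩ := hψ q
      obtain ⟨s, hs⟩ := g.exists_sum m
      refine ⟨s, ?_⟩
      conv_lhs => rw [hs, map_sum]
      exact Finset.sum_congr rfl fun e _ => (key e m).symm }

/-- The degrees of a quotient module. -/
def quotDeg (ℳ : ℤ → AddSubgroup M) (N : Submodule R M) (e : ℤ) : AddSubgroup (M ⧸ N) :=
  (ℳ e).map (N.mkQ : M →+ M ⧸ N)

/-- The submodule `N` is homogeneous. -/
def Grading.IsHomogeneous (g : Grading ℳ) (N : Submodule R M) : Prop :=
  ∀ m ∈ N, ∀ e, g.proj e m ∈ N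

/-- The grading of the quotient by a homogeneous submodule. -/
def Grading.quot (g : Grading ℳ) {N : Submodule R M} (hN : g.IsHomogeneous N) :
    Grading (quotDeg ℳ N) :=
  g.map (N.mkQ : M →+ M ⧸ N) N.mkQ_surjective fun e m hm => by
    have : m ∈ N := (Submodule.Quotient.mk_eq_zero N).1 hm
    exact (Submodule.Quotient.mk_eq_zero N).2 (hN m this e)

theorem Grading.quot_proj (g : Grading ℳ) {N : Submodule R M} (hN : g.IsHomogeneous N) (e : ℤ)
    (m : M) : (g.quot hN).proj e (N.mkQ m) = N.mkQ (g.proj e m) := by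
  obtain ⟨s, hs⟩ := g.exists_sum m
  have hmem : ∀ e, N.mkQ (g.proj e m) ∈ quotDeg ℳ N e := fun e =>
    AddSubgroup.mem_map_of_mem (N.mkQ : M →+ M ⧸ N) (g.proj_mem e m)
  have h1 : N.mkQ m = ∑ e' ∈ s, N.mkQ (g.proj e' m) := by rw [← map_sum, ← hs]
  have h2 : g.proj e m = ∑ e' ∈ s, g.proj e (g.proj e' m) := by rw [← map_sum, ← hs]
  rw [h1, h2, map_sum, map_sum]
  refine Finset.sum_congr rfl fun e' _ => ?_
  by_cases he : e' = e
  · subst he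
    rw [(g.quot hN).proj_self (hmem e'), g.proj_self (g.proj_mem _ _)]
  · rw [(g.quot hN).proj_ne (hmem e') he, g.proj_ne (g.proj_mem _ _) he, map_zero]

theorem Grading.eq_zero (g : Grading ℳ) {m : M} (h : ∀ e, g.proj e m = 0) : m = 0 := by
  obtain ⟨s, hs⟩ := g.exists_sum m
  rw [hs]
  exact Finset.sum_eq_zero fun e _ => h e

theorem Grading.isHomogeneous_comap (g : Grading ℳ) {N : Submodule R M} (hN : g.IsHomogeneous N)
    {K : Submodule R (M ⧸ N)} (hK : (g.quot hN).IsHomogeneous K) :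
    g.IsHomogeneous (K.comap N.mkQ) := fun m hm e => by
  rw [Submodule.mem_comap, ← g.quot_proj hN]
  exact hK _ hm e

theorem SMulDeg.quot {r : R} {d : ℤ} (hr : SMulDeg ℳ r d) (N : Submodule R M) :
    SMulDeg (quotDeg ℳ N) r d := by
  rintro e _ ⟨m, hm, rfl⟩
  exact ⟨r • m, hr hm, map_smul N.mkQ r m⟩

/-- The cokernel of φ is written as a quotient of M itself, by the preimage of the range. This keeps
the Noetherian induction among submodules of M. -/
theorem shortExact_quot {ℒ : ℤ → AddSubgroup L} {N : Submodule R M} {φ : L →ₗ[R] M ⧸ N}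
    (hφ : Function.Injective φ) {d : ℤ} (hd : ∀ {e l}, φ l ∈ quotDeg ℳ N (e + d) ↔ l ∈ ℒ e)
    (hle : N ≤ (LinearMap.range φ).comap N.mkQ) :
    ShortExact ℒ (quotDeg ℳ N) (quotDeg ℳ ((LinearMap.range φ).comap N.mkQ)) d φ
      (Submodule.factor hle) where
  inj := hφ
  exact q hq := by
    obtain ⟨m, rfl⟩ := N.mkQ_surjective q
    exact (Submodule.Quotient.mk_eq_zero _).1 hq
  comp l := by
    obtain ⟨m, hm⟩ := N.mkQ_surjective (φ l)
    rw [← hm]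
    exact (Submodule.Quotient.mk_eq_zero _).2 ⟨l, hm.symm⟩
  mem_iff := hd
  map_mem := by
    rintro e _ ⟨m, hm, rfl⟩
    exact ⟨m, hm, rfl⟩
  lift := by
    rintro e _ ⟨m, hm, rfl⟩
    exact ⟨N.mkQ m, ⟨m, hm, rfl⟩, rfl⟩

end Gradings

/-! ### Vanishing criteria for single modules, and invariance under graded isomorphism. -/

section Vanishing

variable {R : Type*} [CommRing R] {N : ℕ} {x : Fin N → R} {L M : Type*} [AddCommGroup L]
  [Module R L] [AddCommGroup M] [Module R M] {ℒ : ℤ → AddSubgroup L} {ℳ : ℤ → AddSubgroup M}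

theorem vanishes_of_subsingleton [Subsingleton M] (p : ℕ) (e : ℤ) : Vanishes x ℳ p e := by
  intro c _ _
  have : c = 0 := funext fun S => by
    obtain ⟨y, a, h⟩ := exists_frac (c S)
    rw [h, Subsingleton.elim y 0, frac_zero]; rfl
  rw [this]
  exact zero_mem _

theorem vanishes_iff_of_bijective (hM : ∀ i, SMulDeg ℳ (x i) 1) (g : Grading ℳ)
    {φ : L →ₗ[R] M} (hφ : Function.Bijective φ) {d : ℤ}
    (hd : ∀ {e l}, φ l ∈ ℳ (e + d) ↔ l ∈ ℒ e) (p : ℕ) (e : ℤ) :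
    Vanishes x ℒ p e ↔ Vanishes x ℳ p (e + d) := by
  -- A bijection is a short exact sequence with zero third term.
  let 𝒬 : ℤ → AddSubgroup PUnit.{1} := fun _ => ⊤
  let gP : Grading 𝒬 := ⟨fun _ => 0, fun _ _ => trivial, fun _ => rfl, fun _ _ => rfl,
    fun _ => ⟨∅, rfl⟩⟩
  have H : ShortExact ℒ ℳ 𝒬 d φ (0 : M →ₗ[R] PUnit.{1}) :=
    ⟨hφ.1, fun m _ => hφ.2 m, fun _ => rfl, hd, fun _ => trivial,
      fun _ => ⟨0, zero_mem _, rfl⟩⟩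
  constructor
  · exact fun h => H.vanishes_mid gP hM h (vanishes_of_subsingleton _ _)
  · intro h z hz hze
    refine H.mem_coboundaries_left g gP hM (fun q _ => vanishes_of_subsingleton _ _) hze ?_
    refine h _ ⟨mapC_mem φ hz.1, ?_⟩ ((mem_degCochains (hx := hM)).1
      (H.mapC_left_mem ((mem_degCochains (hx := fun i => H.smulDeg_left (hM i))).2 hze)))
    have : _root_.Cech.d x L z = 0 := hz.2
    change _root_.Cech.d x M (mapC φ z) = 0
    rw [← mapC_d, this, map_zero]

theorem vanishes_of_card_lt {p : ℕ} (hp : N < p) (e : ℤ) : Vanishes x ℳ p e := by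
  intro c hc _
  have : c = 0 := funext fun S => hc.1 S fun h => by
    have := S.card_le_univ
    rw [Fintype.card_fin] at this
    omega
  rw [this]
  exact zero_mem _

theorem loc_eq_zero (h : ∀ (i : Fin N) (m : M), x i • m = 0) {S : Finset (Fin N)}
    (hS : S.Nonempty) (u : Loc x M S) : u = 0 := by
  obtain ⟨y, a, rfl⟩ := exists_frac u
  obtain ⟨i, hi⟩ := hS
  refine frac_eq_zero.2 ⟨1, ?_⟩
  rw [pow_one, ← Finset.prod_erase_mul _ _ hi, mul_smul, h, smul_zero]

/-- All M_{x_S} with S nonempty are zero, so the complex reduces to M in the spot S = ∅. -/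
theorem vanishes_of_smul_eq_zero (h : ∀ (i : Fin N) (m : M), x i • m = 0) {e : ℤ}
    (he : ∀ m ∈ ℳ e, m = 0) (p : ℕ) : Vanishes x ℳ p e := by
  intro c _ hce
  have : c = 0 := funext fun S => by
    rcases S.eq_empty_or_nonempty with rfl | hS
    · obtain ⟨y, a, hy, hc⟩ := mem_locDeg.1 (hce ∅)
      rw [hc, he y (by simpa using hy), frac_zero]; rfl
    · exact loc_eq_zero h hS _
  rw [this]
  exact zero_mem _

/-- Placed at S = ∅, m is a cocycle because it dies in every localization, and there are no nonzero
coboundaries in cohomological degree 0. -/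
theorem not_vanishes_zero {e : ℤ} {m : M} (hm : m ∈ ℳ e) (h0 : m ≠ 0)
    (h : ∀ i, x i • m = 0) : ¬ Vanishes x ℳ 0 e := by
  intro H
  let c : Cochains x M := fun S => if S = ∅ then frac x S m 0 else 0
  have hc : c ∈ coboundaries x M 0 := by
    refine H c ⟨fun S hS => if_neg fun hS' => hS (by rw [hS', Finset.card_empty]), ?_⟩ fun S => ?_
    · change d x M c = 0
      funext T
      rw [d_apply]
      refine Finset.sum_eq_zero fun i hi => ?_
      have : res x M (T.erase_subset i) (c (T.erase i)) = 0 := by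
        by_cases hT : T.erase i = ∅
        · simp only [c, if_pos hT, res_frac]
          refine frac_eq_zero.2 ⟨1, ?_⟩
          rw [pow_zero, one_smul, pow_one, ← Finset.prod_erase_mul _ _ hi, mul_smul, h, smul_zero]
        · simp only [c, if_neg hT, map_zero]
      rw [this, smul_zero]
    · by_cases hS : S = ∅
      · subst hS
        simp only [c, if_true]
        exact mem_locDeg_frac (by simpa using hm)
      · simp only [c, if_neg hS]
        exact locDeg_zero
  have hc0 : c = 0 := (Submodule.mem_bot R).1 hc
  have h1 : frac x ∅ m 0 = 0 := by simpa [c] using congrFun hc0 ∅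
  obtain ⟨k, hk⟩ := frac_eq_zero.1 h1
  exact h0 (by simpa using hk)

end Vanishing

/-! ### Homogeneous prime avoidance -/

section Avoidance

variable {k R : Type*} [Field k] [CommRing R] [Algebra k R] (𝒜 : ℕ → Submodule k R)
  [GradedAlgebra 𝒜] {N : ℕ} {x : Fin N → R}

theorem exists_homogeneous_notMem_of_isHomogeneous (hx : ∀ i, x i ∈ 𝒜 1) (s : Finset (Ideal R))
    (hs : ∀ p ∈ s, p.IsPrime ∧ p.IsHomogeneous 𝒜 ∧ ∃ i, x i ∉ p) :
    ∃ d > 0, ∃ f ∈ 𝒜 d, ∀ p ∈ s, f ∉ p := by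
  classical
  induction s using Finset.strongInduction with
  | H s ih =>
    rcases s.eq_empty_or_nonempty with rfl | hne
    · exact ⟨1, one_pos, 0, zero_mem _, by simp⟩
    -- Minimality of p ensures that no other q in s is contained in p, so each such q has a
    -- homogeneous element outside p.
    obtain ⟨p, hp⟩ := s.exists_minimal hne
    obtain ⟨hps, hmin⟩ := hp
    obtain ⟨hpp, -, i, hi⟩ := hs p hps
    obtain ⟨d, hd, f, hf, hfs⟩ := ih _ (Finset.erase_ssubset hps)
      fun q hq => hs q (Finset.mem_of_mem_erase hq)
    by_cases hfp : f ∈ p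
    · have hg : ∀ q : Ideal R, ∃ (e : ℕ) (g : R), q ∈ s.erase p → g ∈ 𝒜 e ∧ g ∈ q ∧ g ∉ p := by
        intro q
        by_cases hq : q ∈ s.erase p
        · have hqp : ¬ q ≤ p := fun h => (Finset.ne_of_mem_erase hq)
            (le_antisymm h (hmin (Finset.mem_of_mem_erase hq) h))
          obtain ⟨a, haq, hap⟩ := Set.not_subset.1 hqp
          by_contra! hcon
          refine hap ?_
          rw [← DirectSum.sum_support_decompose 𝒜 a]
          refine Ideal.sum_mem _ fun e _ => ?_
          by_contra hep
          exact hep ((hcon e _).2 (SetLike.coe_mem _)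
            ((hs q (Finset.mem_of_mem_erase hq)).2.1 e haq))
        · exact ⟨0, 0, fun h => absurd h hq⟩
      choose e g hg using hg
      -- G lies in every q ≠ p but not in p, while f does the opposite. The factor x_i makes the
      -- degree E of G positive, so f^E + G^d is a form of positive degree E·d that avoids all the
      -- primes.
      have hG : x i * ∏ q ∈ s.erase p, g q ∈ 𝒜 (1 + ∑ q ∈ s.erase p, e q) :=
        SetLike.mul_mem_graded (hx i)
          (SetLike.prod_mem_graded 𝒜 e g fun q hq => (hg q hq).1)
      set G := x i * ∏ q ∈ s.erase p, g q with hGdef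
      set E := 1 + ∑ q ∈ s.erase p, e q with hE
      have hGp : G ∉ p := fun h => by
        rcases hpp.mem_or_mem h with h | h
        · exact hi h
        · obtain ⟨q, hq, hq'⟩ := (hpp.prod_mem_iff).1 h
          exact (hg q hq).2.2 hq'
      have hGq : ∀ q ∈ s.erase p, G ∈ q := fun q hq =>
        Ideal.mul_mem_left _ _ (Ideal.mem_of_dvd _ (Finset.dvd_prod_of_mem g hq) (hg q hq).2.1)
      refine ⟨E * d, Nat.mul_pos (by omega) hd, f ^ E + G ^ d, add_mem ?_ ?_, fun q hq h => ?_⟩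
      · simpa using SetLike.pow_mem_graded E hf
      · have := SetLike.pow_mem_graded d hG
        rwa [smul_eq_mul, mul_comm] at this
      · by_cases hqp : q = p
        · subst hqp
          have h1 : f ^ E ∈ q := q.pow_mem_of_mem hfp _ (by omega)
          exact hGp (hpp.mem_of_pow_mem _ ((q.add_mem_iff_right h1).1 h))
        · have hq' := Finset.mem_erase.2 ⟨hqp, hq⟩
          have h1 : G ^ d ∈ q := q.pow_mem_of_mem (hGq q hq') _ hd
          exact hfs q hq' ((hs q hq).1.mem_of_pow_mem _ ((q.add_mem_iff_left h1).1 h))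
    · refine ⟨d, hd, f, hf, fun q hq => ?_⟩
      by_cases hqp : q = p
      · rwa [hqp]
      · exact hfs q (Finset.mem_erase.2 ⟨hqp, hq⟩)

/-- A form lies in p exactly when it lies in the homogeneous core of p, which is again prime.
Homogeneity of associated primes is thus not needed. -/
theorem exists_homogeneous_notMem (hx : ∀ i, x i ∈ 𝒜 1) (s : Finset (Ideal R))
    (hs : ∀ p ∈ s, p.IsPrime ∧ ∃ i, x i ∉ p) : ∃ d > 0, ∃ f ∈ 𝒜 d, ∀ p ∈ s, f ∉ p := by
  classical
  obtain ⟨d, hd, f, hf, h⟩ := exists_homogeneous_notMem_of_isHomogeneous 𝒜 hx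
    (s.image fun p => (p.homogeneousCore 𝒜).toIdeal) (by
      intro q hq
      obtain ⟨p, hp, rfl⟩ := Finset.mem_image.1 hq
      obtain ⟨hpp, i, hi⟩ := hs p hp
      exact ⟨hpp.homogeneousCore, (p.homogeneousCore 𝒜).isHomogeneous,
        i, fun h => hi (Ideal.toIdeal_homogeneousCore_le 𝒜 p h)⟩)
  refine ⟨d, hd, f, hf, fun p hp hfp => h _ (Finset.mem_image_of_mem _ hp) ?_⟩
  exact Ideal.mem_homogeneousCore_of_homogeneous_of_mem ⟨d, hf⟩ hfp

/-- An associated prime containing all x_i would be the annihilator of a nonzero element killed by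
all x_i. The zero divisors on M are the union of the finitely many associated primes, so prime
avoidance applies. -/
theorem exists_homogeneous_regular [IsNoetherianRing R] (hx : ∀ i, x i ∈ 𝒜 1) (M : Type*)
    [AddCommGroup M] [Module R M] [Module.Finite R M]
    (hM : ∀ m : M, (∀ i, x i • m = 0) → m = 0) :
    ∃ d > 0, ∃ f ∈ 𝒜 d, ∀ m : M, f • m = 0 → m = 0 := by
  obtain ⟨d, hd, f, hf, h⟩ := exists_homogeneous_notMem 𝒜 hx
    (associatedPrimes.finite R M).toFinset (by
      intro p hp
      rw [Set.Finite.mem_toFinset, AssociatedPrimes.mem_iff, isAssociatedPrime_iff] at hp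
      obtain ⟨hpp, m, hm⟩ := hp
      refine ⟨hpp, ?_⟩
      by_contra! hcon
      have h0 : m = 0 := hM m fun i => by
        have := hcon i
        rwa [hm, Submodule.mem_colon_singleton, Submodule.mem_bot] at this
      refine hpp.ne_top ((Ideal.eq_top_iff_one _).2 ?_)
      rw [hm, Submodule.mem_colon_singleton, h0, smul_zero]
      exact zero_mem _)
  refine ⟨d, hd, f, hf, fun m hm => ?_⟩
  by_contra hne
  have : f ∈ ⋃ p ∈ associatedPrimes R M, (p : Set R) := by
    rw [biUnion_associatedPrimes_eq_zero_divisors]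
    exact ⟨m, hne, hm⟩
  simp only [Set.mem_iUnion] at this
  obtain ⟨p, hp, hfp⟩ := this
  exact h p ((Set.Finite.mem_toFinset _).2 hp) hfp

end Avoidance

end Cech
end

noncomputable section
/-! ### Vanishing and non-vanishing of graded local cohomology -/

namespace Cech

section Noetherian

variable {k R : Type*} [Field k] [CommRing R] [Algebra k R] {𝒜 : ℕ → Submodule k R}
  [GradedAlgebra 𝒜] {N : ℕ} {x : Fin N → R} {M : Type*} [AddCommGroup M] [Module R M]
  {ℳ : ℤ → AddSubgroup M}

/-- The components of a of positive degree kill m, so only the degree 0 part of a acts. -/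
theorem smul_mem_of_smul_eq_zero
    (hirr : ∀ d > 0, ∀ a ∈ 𝒜 d, a ∈ Ideal.span (Set.range x))
    (hact : ∀ d, ∀ a ∈ 𝒜 d, SMulDeg ℳ a d) {e : ℤ} {m : M} (hm : m ∈ ℳ e)
    (h : ∀ i, x i • m = 0) (a : R) : a • m ∈ ℳ e := by
  classical
  have h0 : ∀ b ∈ Ideal.span (Set.range x), b • m = 0 := fun b hb => by
    have : Ideal.span (Set.range x) ≤ LinearMap.ker (LinearMap.toSpanSingleton R M m) := by
      rw [Ideal.span_le]
      rintro _ ⟨i, rfl⟩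
      simpa using h i
    simpa using this hb
  rw [← DirectSum.sum_support_decompose 𝒜 a, Finset.sum_smul]
  refine sum_mem fun d _ => ?_
  rcases Nat.eq_zero_or_pos d with rfl | hd
  · simpa using hact 0 _ (SetLike.coe_mem _) hm
  · rw [h0 _ (hirr d hd _ (SetLike.coe_mem _))]
    exact zero_mem _

theorem exists_homogeneous_of_smul_eq_zero (g : Grading ℳ) (hx : ∀ i, SMulDeg ℳ (x i) 1) {m : M}
    (hm : m ≠ 0) (h : ∀ i, x i • m = 0) :
    ∃ e, ∃ m' ∈ ℳ e, m' ≠ 0 ∧ ∀ i, x i • m' = 0 := by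
  by_contra! hcon
  refine hm (g.eq_zero fun e => ?_)
  by_contra hne
  obtain ⟨i, hi⟩ := hcon e _ (g.proj_mem e m) hne
  exact hi (by rw [← g.proj_smul (hx i), h, map_zero])

variable (g : Grading ℳ) (hirr : ∀ d > 0, ∀ a ∈ 𝒜 d, a ∈ Ideal.span (Set.range x))
  (hact : ∀ d, ∀ a ∈ 𝒜 d, SMulDeg ℳ a d) (hx : ∀ i, x i ∈ 𝒜 1)

omit [GradedAlgebra 𝒜] in
include hact hx in
theorem smulDeg_var (i : Fin N) : SMulDeg ℳ (x i) 1 := by simpa using hact 1 _ (hx i)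

include g in
theorem mem_of_smul_mem {f : R} {d : ℤ} (hf : SMulDeg ℳ f d)
    (hreg : ∀ m : M, f • m = 0 → m = 0) {e : ℤ} {m : M} (hm : f • m ∈ ℳ (e + d)) : m ∈ ℳ e := by
  have h1 : f • (m - g.proj e m) = 0 := by
    rw [smul_sub, ← g.proj_smul hf, g.proj_self hm, sub_self]
  rw [sub_eq_zero.1 (hreg _ h1)]
  exact g.proj_mem _ _

theorem shortExact_of_regular (g : Grading ℳ) {K : Submodule R M} (hK : g.IsHomogeneous K)
    {f : R} {d : ℤ} (hf : SMulDeg ℳ f d) (hreg : ∀ m : M ⧸ K, f • m = 0 → m = 0)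
    (hle : K ≤ (LinearMap.range (f • LinearMap.id : M ⧸ K →ₗ[R] M ⧸ K)).comap K.mkQ) :
    ShortExact (quotDeg ℳ K) (quotDeg ℳ K)
      (quotDeg ℳ ((LinearMap.range (f • LinearMap.id : M ⧸ K →ₗ[R] M ⧸ K)).comap K.mkQ)) d
      (f • LinearMap.id : M ⧸ K →ₗ[R] M ⧸ K) (Submodule.factor hle) :=
  shortExact_quot ((injective_iff_map_eq_zero _).2 hreg)
    (fun {_ _} => ⟨fun h => mem_of_smul_mem (g.quot hK) (hf.quot K) hreg h,
      fun h => hf.quot K h⟩) hle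

theorem le_comap_mkQ (K : Submodule R M) (K' : Submodule R (M ⧸ K)) : K ≤ K'.comap K.mkQ :=
  fun m hm => by
    rw [Submodule.mem_comap, Submodule.mkQ_apply, (Submodule.Quotient.mk_eq_zero K).2 hm]
    exact zero_mem _

theorem lt_comap_mkQ (K : Submodule R M) {K' : Submodule R (M ⧸ K)} {q : M ⧸ K} (hq : q ∈ K')
    (h0 : q ≠ 0) : K < K'.comap K.mkQ := by
  refine lt_of_le_of_ne (le_comap_mkQ K K') fun h => ?_
  obtain ⟨m, rfl⟩ := K.mkQ_surjective q
  have : m ∈ K := by rw [h]; exact hq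
  exact h0 ((Submodule.Quotient.mk_eq_zero K).2 this)

theorem isHomogeneous_range_smul (g : Grading ℳ) {f : R} {d : ℤ} (hf : SMulDeg ℳ f d) :
    g.IsHomogeneous (LinearMap.range (f • LinearMap.id : M →ₗ[R] M)) := by
  rintro _ ⟨q, rfl⟩ e
  refine ⟨g.proj (e - d) q, ?_⟩
  have := g.proj_smul hf (e - d) q
  rw [sub_add_cancel] at this
  exact this.symm

include hirr hact in
theorem mem_of_mem_span_singleton {e : ℤ} {m : M} (hm : m ∈ ℳ e) (h : ∀ i, x i • m = 0) {l : M}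
    (hl : l ∈ Submodule.span R {m}) : l ∈ ℳ e ∧ ∀ i, x i • l = 0 := by
  obtain ⟨a, rfl⟩ := Submodule.mem_span_singleton.1 hl
  exact ⟨smul_mem_of_smul_eq_zero hirr hact hm h a,
    fun i => by rw [smul_comm, h, smul_zero]⟩

include g hirr hact hx in
/-- Graded local cohomology of a finitely generated module vanishes in high degrees. -/
theorem exists_forall_vanishes_quot [IsNoetherianRing R] [Module.Finite R M] (K : Submodule R M)
    (hK : g.IsHomogeneous K) : ∃ E : ℤ, ∀ p e, E ≤ e → Vanishes x (quotDeg ℳ K) p e := by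
  have hvar := smulDeg_var (ℳ := ℳ) hact hx
  induction K using WellFoundedGT.induction with
  | ind K ih =>
    have hvar' : ∀ i, SMulDeg (quotDeg ℳ K) (x i) 1 := fun i => (hvar i).quot K
    by_cases htor : ∀ q : M ⧸ K, (∀ i, x i • q = 0) → q = 0
    · by_cases hsub : Subsingleton (M ⧸ K)
      · exact ⟨0, fun p e _ => vanishes_of_subsingleton p e⟩
      obtain ⟨d, hd, f, hf, hreg⟩ := exists_homogeneous_regular 𝒜 hx (M ⧸ K) htor
      have hle := le_comap_mkQ K (LinearMap.range (f • LinearMap.id : M ⧸ K →ₗ[R] M ⧸ K))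
      have H := shortExact_of_regular g hK (hact d f hf) hreg hle
      obtain ⟨q, hq⟩ := @exists_ne _ (not_subsingleton_iff_nontrivial.1 hsub) (0 : M ⧸ K)
      have hlt : K < (LinearMap.range (f • LinearMap.id : M ⧸ K →ₗ[R] M ⧸ K)).comap K.mkQ :=
        lt_comap_mkQ K (q := f • q) ⟨q, rfl⟩ fun h => hq (hreg q h)
      have hhom := g.isHomogeneous_comap hK
        (isHomogeneous_range_smul (g.quot hK) ((hact d f hf).quot K))
      obtain ⟨E, hE⟩ := ih _ hlt hhom
      -- The bound for the cokernel also works here: in degrees ≥ E multiplication by f is injective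
      -- on cohomology, while a power of f kills each class. The induction on the exponent replaces
      -- z by f z, of degree e + d ≥ E.
      refine ⟨E, fun p e he z hz hze => ?_⟩
      obtain ⟨a, ha⟩ := exists_pow_smul_mem_coboundaries_of_mem hz (hirr d hd f hf)
      induction a generalizing e z with
      | zero => simpa using ha
      | succ a iha =>
        have hfz : f • z ∈ coboundaries x (M ⧸ K) p := by
          refine iha (e + d) (by omega) (f • z) (Submodule.smul_mem _ _ hz)
            (fun S => locDeg_smul ((hact d f hf).quot K) (hze S)) ?_
          rwa [smul_smul, ← pow_succ]
        refine H.mem_coboundaries_left (g.quot hK) (g.quot hhom) hvar'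
          (fun q _ => hE q _ (by omega)) hze ?_
        have : mapC (x := x) (f • LinearMap.id : M ⧸ K →ₗ[R] M ⧸ K) z = f • z := by
          funext S
          obtain ⟨y, b, h⟩ := exists_frac (z S)
          rw [mapC_apply, Pi.smul_apply, h, locMap_frac, smul_frac]
          rfl
        rwa [this]
    · push Not at htor
      obtain ⟨q, hq, hq0⟩ := htor
      -- The submodule generated by m is killed by the variables and lives in degree e₀ only, so
      -- dividing it out affects no cohomology in degrees above e₀.
      obtain ⟨e₀, m, hm, hm0, hmx⟩ :=
        exists_homogeneous_of_smul_eq_zero (g.quot hK) hvar' hq0 hq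
      have hact' : ∀ d, ∀ a ∈ 𝒜 d, SMulDeg (quotDeg ℳ K) a d := fun d a ha => (hact d a ha).quot K
      have hspan := fun l (hl : l ∈ Submodule.span R {m}) =>
        mem_of_mem_span_singleton hirr hact' hm hmx hl
      let φ := (Submodule.span R {m}).subtype
      have hrange : LinearMap.range φ = Submodule.span R {m} := Submodule.range_subtype _
      have hle := le_comap_mkQ K (LinearMap.range φ)
      have H := shortExact_quot (ℳ := ℳ) (φ := φ) (d := 0)
        (ℒ := fun e => (quotDeg ℳ K e).comap (φ : _ →+ M ⧸ K)) Subtype.val_injective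
        (fun {e l} => by rw [add_zero]; rfl) hle
      have hlt : K < (LinearMap.range φ).comap K.mkQ :=
        lt_comap_mkQ K (by rw [hrange]; exact Submodule.mem_span_singleton_self m) hm0
      have hhom := g.isHomogeneous_comap hK (K := LinearMap.range φ) fun l hl e => by
        rw [hrange] at hl ⊢
        by_cases he : e₀ = e
        · subst he
          rwa [(g.quot hK).proj_self (hspan l hl).1]
        · rw [(g.quot hK).proj_ne (hspan l hl).1 he]
          exact zero_mem _
      obtain ⟨E, hE⟩ := ih _ hlt hhom
      refine ⟨max E (e₀ + 1), fun p e he => ?_⟩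
      rw [← add_zero e]
      refine H.vanishes_mid (g.quot hhom) hvar' (vanishes_of_smul_eq_zero
        (fun i l => Subtype.ext ((hspan l.1 l.2).2 i)) (fun l hl => ?_) p)
        (by rw [add_zero]; exact hE p e (le_trans (le_max_left _ _) he))
      refine Subtype.ext ?_
      have hne : e₀ ≠ e := by have := le_max_right E (e₀ + 1); omega
      have h1 := (g.quot hK).proj_ne (hspan l.1 l.2).1 hne
      exact ((g.quot hK).proj_self hl).symm.trans h1

include g in
-- Graded Nakayama: a nonzero element of least degree e would be f times a nonzero element of degree
-- e - d.
theorem subsingleton_of_surjective_smul {B : ℤ} (hB : ∀ e < B, ℳ e = ⊥) {f : R} {d : ℤ}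
    (hd : 0 < d) (hf : SMulDeg ℳ f d) (hsurj : ∀ m : M, ∃ m', f • m' = m) : ∀ m : M, m = 0 := by
  by_contra! hcon
  obtain ⟨m, hm⟩ := hcon
  have hex : ∃ e, ∃ m ∈ ℳ e, m ≠ 0 := by
    by_contra! h
    exact hm (g.eq_zero fun e => h e _ (g.proj_mem e m))
  obtain ⟨e, ⟨m, hme, hm0⟩, hmin⟩ := Int.exists_least_of_bdd
    (P := fun e => ∃ m ∈ ℳ e, m ≠ 0) ⟨B, fun e ⟨m, hme, hm0⟩ => by
      by_contra! h
      rw [hB e h] at hme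
      exact hm0 hme⟩ hex
  obtain ⟨m', rfl⟩ := hsurj m
  have h1 := g.proj_smul hf (e - d) m'
  rw [sub_add_cancel, g.proj_self hme] at h1
  refine hm0 ?_
  rw [h1]
  by_contra hne
  have := hmin (e - d) ⟨_, g.proj_mem (e - d) m', fun h => hne (by rw [h, smul_zero])⟩
  omega

include g hact hx in
/-- Graded local cohomology of a non-zero finitely generated module does not vanish. -/
theorem eq_top_of_forall_vanishes [IsNoetherianRing R] [Module.Finite R M] {B : ℤ}
    (hB : ∀ e < B, ℳ e = ⊥) (K : Submodule R M) (hK : g.IsHomogeneous K)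
    (hV : ∀ p e, Vanishes x (quotDeg ℳ K) p e) : K = ⊤ := by
  have hvar := smulDeg_var (ℳ := ℳ) hact hx
  induction K using WellFoundedGT.induction with
  | ind K ih =>
    have hvar' : ∀ i, SMulDeg (quotDeg ℳ K) (x i) 1 := fun i => (hvar i).quot K
    by_cases htor : ∀ q : M ⧸ K, (∀ i, x i • q = 0) → q = 0
    · obtain ⟨d, hd, f, hf, hreg⟩ := exists_homogeneous_regular 𝒜 hx (M ⧸ K) htor
      have hle := le_comap_mkQ K (LinearMap.range (f • LinearMap.id : M ⧸ K →ₗ[R] M ⧸ K))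
      have H := shortExact_of_regular g hK (hact d f hf) hreg hle
      by_contra htop
      obtain ⟨q, hq⟩ :=
        @exists_ne _ (Submodule.Quotient.nontrivial_iff.2 htop) (0 : M ⧸ K)
      have hlt : K < (LinearMap.range (f • LinearMap.id : M ⧸ K →ₗ[R] M ⧸ K)).comap K.mkQ :=
        lt_comap_mkQ K (q := f • q) ⟨q, rfl⟩ fun h => hq (hreg q h)
      have hhom := g.isHomogeneous_comap hK
        (isHomogeneous_range_smul (g.quot hK) ((hact d f hf).quot K))
      -- The vanishing passes to the cokernel of f, which is then zero by induction; so f acts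
      -- surjectively on M/K.
      have htop' := ih _ hlt hhom fun p e => by
        rw [← sub_add_cancel e (d : ℤ)]
        exact H.vanishes_right (g.quot hK) hvar' (hV p _) (hV (p + 1) _)
      refine hq (subsingleton_of_surjective_smul (g.quot hK) (B := B) (fun e he => ?_)
        (Int.natCast_pos.2 hd) ((hact d f hf).quot K) (fun q' => ?_) q)
      · rw [quotDeg, hB e he, AddSubgroup.map_bot]
      · obtain ⟨m, rfl⟩ := K.mkQ_surjective q'
        have : m ∈ (LinearMap.range (f • LinearMap.id : M ⧸ K →ₗ[R] M ⧸ K)).comap K.mkQ := by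
          rw [htop']; trivial
        exact this
    · push Not at htor
      obtain ⟨q, hq, hq0⟩ := htor
      obtain ⟨e₀, m, hm, hm0, hmx⟩ :=
        exists_homogeneous_of_smul_eq_zero (g.quot hK) hvar' hq0 hq
      exact absurd (hV 0 e₀) (not_vanishes_zero hm hm0 hmx)

include g in
theorem vanishes_quot_bot (hvar : ∀ i, SMulDeg ℳ (x i) 1) (p : ℕ) (e : ℤ) :
    Vanishes x (quotDeg ℳ (⊥ : Submodule R M)) p e ↔ Vanishes x ℳ p e := by
  have hK : g.IsHomogeneous (⊥ : Submodule R M) := fun m hm e => by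
    rw [(Submodule.mem_bot R).1 hm, map_zero]; exact zero_mem _
  have hinj : Function.Injective (⊥ : Submodule R M).mkQ := by
    rw [← LinearMap.ker_eq_bot, Submodule.ker_mkQ]
  have := vanishes_iff_of_bijective (fun i => (hvar i).quot ⊥) (g.quot hK)
    (ℒ := ℳ) (φ := (⊥ : Submodule R M).mkQ) ⟨hinj, Submodule.mkQ_surjective _⟩ (d := 0)
    (fun {e m} => by
      rw [add_zero]
      constructor
      · rintro ⟨m', hm', h⟩
        rwa [← hinj h]
      · exact fun h => ⟨m, h, rfl⟩) p e
  rw [this, add_zero]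

include g hirr hact hx in
/-- The regularity of a non-zero finitely generated graded module is an integer. -/
theorem exists_reg_eq [IsNoetherianRing R] [Module.Finite R M] [Nontrivial M] {B : ℤ}
    (hB : ∀ e < B, ℳ e = ⊥) : ∃ a : ℤ, reg x ℳ = ((a : ℝ) : EReal) := by
  have hvar := smulDeg_var (ℳ := ℳ) hact hx
  have hK : g.IsHomogeneous (⊥ : Submodule R M) := fun m hm e => by
    rw [(Submodule.mem_bot R).1 hm, map_zero]; exact zero_mem _
  obtain ⟨E, hE⟩ := exists_forall_vanishes_quot g hirr hact hx ⊥ hK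
  have hne : ∃ p e, ¬ Vanishes x ℳ p e := by
    by_contra! h
    exact bot_ne_top (eq_top_of_forall_vanishes g hact hx hB ⊥ hK fun p e =>
      (vanishes_quot_bot g hvar p e).2 (h p e))
  have hbd : ∀ p e, ¬ Vanishes x ℳ p e → e + p ≤ E + N := by
    intro p e h
    have h1 : e < E := by
      by_contra! h'
      exact h ((vanishes_quot_bot g hvar p e).1 (hE p e h'))
    have h2 : p ≤ N := by
      by_contra! h'
      exact h (vanishes_of_card_lt h' e)
    omega
  -- The values e + p with nonzero H^p(M)_e form a nonempty set of integers bounded above; its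
  -- maximum is the regularity.
  obtain ⟨a, ⟨p, e, hpe, rfl⟩, hmax⟩ := Int.exists_greatest_of_bdd
    (P := fun a => ∃ (p : ℕ) (e : ℤ), ¬ Vanishes x ℳ p e ∧ e + p = a)
    ⟨E + N, fun a ⟨p, e, h, h'⟩ => h' ▸ hbd p e h⟩
    (by obtain ⟨p, e, h⟩ := hne; exact ⟨_, p, e, h, rfl⟩)
  refine ⟨e + p, le_antisymm (iSup_le fun q => ?_) (le_iSup_of_le p ?_)⟩
  · have h1 : endH x ℳ q ≤ ((e + p - q : ℝ) : EReal) := by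
      refine iSup₂_le fun e' he' => EReal.coe_le_coe_iff.2 ?_
      have := hmax (e' + q) ⟨q, e', fun h => vanishes_iff.1 h he', rfl⟩
      have h2 : ((e' + q : ℤ) : ℝ) ≤ ((e + p : ℤ) : ℝ) := Int.cast_le.2 this
      push_cast at h2
      linarith
    refine (add_le_add_left h1 _).trans (le_of_eq ?_)
    rw [← EReal.coe_natCast, ← EReal.coe_add]
    exact congrArg Real.toEReal (by push_cast; ring)
  · have h1 : ((e : ℝ) : EReal) ≤ endH x ℳ p :=
      le_iSup₂_of_le e (not_not.1 fun h => hpe (vanishes_iff.2 h)) le_rfl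
    refine le_trans (le_of_eq ?_) (add_le_add_left h1 _)
    rw [← EReal.coe_natCast, ← EReal.coe_add]
    exact congrArg Real.toEReal (by push_cast; ring)

end Noetherian

/-! ### Behaviour of regularity under degree shifts. -/

section Shift

variable {R : Type*} [CommRing R] {N : ℕ} {x : Fin N → R} {L M : Type*} [AddCommGroup L]
  [Module R L] [AddCommGroup M] [Module R M] {ℒ : ℤ → AddSubgroup L} {ℳ : ℤ → AddSubgroup M}

/-- An isomorphism of degree `d` changes the regularity by `d`. -/
theorem reg_eq_add_of_bijective (hM : ∀ i, SMulDeg ℳ (x i) 1) (g : Grading ℳ)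
    {φ : L →ₗ[R] M} (hφ : Function.Bijective φ) {d : ℤ}
    (hd : ∀ {e l}, φ l ∈ ℳ (e + d) ↔ l ∈ ℒ e) :
    reg x ℳ = reg x ℒ + ((d : ℝ) : EReal) := by
  have key := vanishes_iff_of_bijective hM g hφ hd
  have hle1 : reg x ℳ ≤ reg x ℒ + ((d : ℝ) : EReal) := by
    refine iSup_le fun p => ?_
    have h1 : endH x ℳ p ≤ endH x ℒ p + ((d : ℝ) : EReal) := by
      refine iSup₂_le fun e he => ?_
      have h2 : ((((e - d : ℤ)) : ℝ) : EReal) ≤ endH x ℒ p :=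
        le_iSup₂_of_le (e - d) (not_not.1 fun h => vanishes_iff.1
          (by have := (key p (e - d)).1 (vanishes_iff.2 h); rwa [sub_add_cancel] at this) he) le_rfl
      refine le_trans (le_of_eq ?_) (add_le_add_left h2 _)
      rw [← EReal.coe_add]
      exact congrArg Real.toEReal (by push_cast; ring)
    refine (add_le_add_left h1 _).trans ?_
    rw [add_right_comm]
    exact add_le_add_left (le_iSup (fun p : ℕ => endH x ℒ p + (p : EReal)) p) _
  have hle2 : reg x ℒ ≤ reg x ℳ + ((-d : ℝ) : EReal) := by
    refine iSup_le fun p => ?_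
    have h1 : endH x ℒ p ≤ endH x ℳ p + ((-d : ℝ) : EReal) := by
      refine iSup₂_le fun e he => ?_
      have h2 : ((((e + d : ℤ)) : ℝ) : EReal) ≤ endH x ℳ p :=
        le_iSup₂_of_le (e + d) (not_not.1 fun h => vanishes_iff.1
          ((key p e).2 (vanishes_iff.2 h)) he) le_rfl
      refine le_trans (le_of_eq ?_) (add_le_add_left h2 _)
      rw [← EReal.coe_add]
      exact congrArg Real.toEReal (by push_cast; ring)
    refine (add_le_add_left h1 _).trans ?_
    rw [add_right_comm]
    exact add_le_add_left (le_iSup (fun p : ℕ => endH x ℳ p + (p : EReal)) p) _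
  refine le_antisymm hle1 ((add_le_add_left hle2 _).trans (le_of_eq ?_))
  rw [add_assoc, ← EReal.coe_add, neg_add_cancel, EReal.coe_zero, add_zero]

end Shift

end Cech
end

noncomputable section
attribute [local instance] MvPolynomial.gradedAlgebra
/-! ### The grading of the homogeneous coordinate ring -/

namespace ProjVariety

variable {k : Type*} [Field k] {n : ℕ} (X : ProjVariety k n)

instance forms_gradedMonoid : SetLike.GradedMonoid X.forms where
  one_mem := ⟨1, MvPolynomial.isHomogeneous_one _ _, map_one (Ideal.Quotient.mkₐ k X.ideal)⟩
  mul_mem := by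
    rintro d e _ _ ⟨s, hs, rfl⟩ ⟨t, ht, rfl⟩
    exact ⟨s * t, MvPolynomial.IsHomogeneous.mul hs ht,
      map_mul (Ideal.Quotient.mkₐ k X.ideal) s t⟩

/-- As P is homogeneous, a relation among forms of different degrees lifts to an element of P whose
components all lie in P. -/
theorem forms_isInternal : DirectSum.IsInternal X.forms := by
  classical
  constructor
  · rw [injective_iff_map_eq_zero]
    intro v hv
    have hlift : ∀ d, ∃ s ∈ MvPolynomial.homogeneousSubmodule (Fin (n + 1)) k d,
        Ideal.Quotient.mk X.ideal s = v d := fun d => (v d).2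
    choose s hs hsv using hlift
    have hsum : ∑ d ∈ DFinsupp.support v, s d ∈ X.ideal := by
      rw [← Ideal.Quotient.eq_zero_iff_mem, map_sum, ← hv, DirectSum.coeAddMonoidHom_eq_dfinsuppSum]
      exact Finset.sum_congr rfl fun d _ => hsv d
    ext e
    by_cases he : e ∈ DFinsupp.support v
    · have h1 := X.isHomogeneous e hsum
      rw [DirectSum.decompose_sum, DFinsupp.finsetSum_apply, AddSubmonoidClass.coe_finsetSum,
        Finset.sum_eq_single_of_mem e he fun d _ hd =>
          DirectSum.decompose_of_mem_ne _ (hs d) hd,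
        DirectSum.decompose_of_mem_same _ (hs e)] at h1
      rw [← hsv e, Ideal.Quotient.eq_zero_iff_mem.2 h1]
      rfl
    · rw [DFinsupp.notMem_support_iff.1 he]
      rfl
  · intro a
    obtain ⟨s, rfl⟩ := Ideal.Quotient.mk_surjective a
    refine ⟨∑ d ∈ DFinsupp.support (DirectSum.decompose
      (MvPolynomial.homogeneousSubmodule (Fin (n + 1)) k) s), DirectSum.of (fun d => X.forms d) d
        ⟨Ideal.Quotient.mk X.ideal (DirectSum.decompose
          (MvPolynomial.homogeneousSubmodule (Fin (n + 1)) k) s d),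
          ⟨_, SetLike.coe_mem _, rfl⟩⟩, ?_⟩
    rw [map_sum]
    simp only [DirectSum.coeAddMonoidHom_of]
    rw [← map_sum, DirectSum.sum_support_decompose]

instance forms_gradedAlgebra : GradedAlgebra X.forms :=
  { X.forms_gradedMonoid, X.forms_isInternal.chooseDecomposition with }

theorem var_mem_forms (i : Fin (n + 1)) : X.var i ∈ X.forms 1 :=
  ⟨MvPolynomial.X i, MvPolynomial.isHomogeneous_X _ _, rfl⟩

theorem forms_subset_span_var (d : ℕ) (hd : d > 0) (a : X.Coord) (ha : a ∈ X.forms d) :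
    a ∈ Ideal.span (Set.range X.var) := by
  obtain ⟨s, hs, rfl⟩ := ha
  have h1 : s ∈ Ideal.span (Set.range (MvPolynomial.X (R := k) (σ := Fin (n + 1)))) := by
    rw [← Set.image_univ, MvPolynomial.mem_ideal_span_X_image]
    intro m hm
    by_contra! hcon
    have hdeg : Finsupp.degree m = d := by
      by_contra hne
      exact (MvPolynomial.mem_support_iff.1 hm)
        (MvPolynomial.IsHomogeneous.coeff_eq_zero hs hne)
    have : m = 0 := Finsupp.ext fun i => hcon i trivial
    rw [this, map_zero] at hdeg
    omega
  have h2 := Ideal.mem_map_of_mem (Ideal.Quotient.mk X.ideal) h1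
  rw [Ideal.map_span, ← Set.range_comp] at h2
  exact h2

/-- The grading of the homogeneous coordinate ring. -/
def grading : Cech.Grading X.deg where
  proj
    | Int.ofNat d => GradedRing.proj X.forms d
    | Int.negSucc _ => 0
  proj_mem
    | Int.ofNat d, _ => SetLike.coe_mem _
    | Int.negSucc _, _ => zero_mem _
  proj_self {e m} hm := by
    cases e with
    | ofNat d => exact DirectSum.decompose_of_mem_same X.forms hm
    | negSucc d => exact ((AddSubgroup.mem_bot).1 hm).symm
  proj_ne {e e' m} hm hne := by
    cases e' with
    | negSucc d => rfl
    | ofNat d' =>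
      cases e with
      | ofNat d =>
        exact DirectSum.decompose_of_mem_ne X.forms hm fun h => hne (congrArg Int.ofNat h)
      | negSucc d => rw [(AddSubgroup.mem_bot).1 hm, map_zero]
  exists_sum m := by
    classical
    refine ⟨(DFinsupp.support (DirectSum.decompose X.forms m)).map
      ⟨Int.ofNat, fun _ _ h => Int.ofNat.inj h⟩, ?_⟩
    rw [Finset.sum_map]
    exact (DirectSum.sum_support_decompose X.forms m).symm

theorem smulDeg_forms (d : ℕ) (a : X.Coord) (ha : a ∈ X.forms d) :
    Cech.SMulDeg X.deg a (d : ℤ) := by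
  intro e m hm
  cases e with
  | ofNat e =>
    have : m * a ∈ X.forms (e + d) := SetLike.mul_mem_graded hm ha
    rw [smul_eq_mul, mul_comm]
    exact this
  | negSucc e =>
    rw [(AddSubgroup.mem_bot).1 hm, smul_zero]
    exact zero_mem _

/-- The degrees of an ideal. -/
def idealDeg (I : Ideal X.Coord) (e : ℤ) : AddSubgroup I :=
  (X.deg e).comap (I.subtype : I →+ X.Coord)

variable {X}

/-- The grading of a homogeneous ideal. -/
def idealGrading {I : Ideal X.Coord} (hI : I.IsHomogeneous X.forms) :
    Cech.Grading (X.idealDeg I) :=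
  X.grading.comap (I.subtype : I →+ X.Coord) Subtype.val_injective fun e l => by
    cases e with
    | ofNat d => exact ⟨⟨_, hI d l.2⟩, rfl⟩
    | negSucc d => exact ⟨0, rfl⟩

theorem smulDeg_ideal (I : Ideal X.Coord) (d : ℕ) (a : X.Coord) (ha : a ∈ X.forms d) :
    Cech.SMulDeg (X.idealDeg I) a (d : ℤ) := fun _ _ hm => X.smulDeg_forms d a ha hm

theorem exists_reg_eq {I : Ideal X.Coord} (hI : I.IsHomogeneous X.forms) (h0 : I ≠ ⊥) :
    ∃ a : ℤ, X.reg I = ((a : ℝ) : EReal) := by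
  have : Nontrivial I := (Submodule.nontrivial_iff_ne_bot).2 h0
  refine Cech.exists_reg_eq (idealGrading hI) X.forms_subset_span_var (smulDeg_ideal I)
    X.var_mem_forms (B := 0) fun e he => ?_
  cases e with
  | ofNat d => exact absurd he (not_lt.2 (Int.natCast_nonneg d))
  | negSucc d =>
    rw [eq_bot_iff]
    intro l hl
    exact Subtype.ext ((AddSubgroup.mem_bot).1 hl)

theorem isHomogeneous_pow {I : Ideal X.Coord} (hI : I.IsHomogeneous X.forms) (r : ℕ) :
    (I ^ r).IsHomogeneous X.forms := by
  induction r with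
  | zero =>
    rw [Submodule.pow_zero, Ideal.one_eq_top]
    exact Ideal.IsHomogeneous.top _
  | succ r ih =>
    rw [Submodule.pow_succ]
    exact ih.mul hI

theorem isHomogeneous_span_singleton {d : ℕ} {a : X.Coord} (ha : a ∈ X.forms d) :
    (Ideal.span {a}).IsHomogeneous X.forms :=
  Ideal.homogeneous_span _ _ fun b hb => ⟨d, by rwa [Set.mem_singleton_iff.1 hb]⟩

/-- Multiplication by a form `a` shifts the regularity of an ideal by the degree of `a`. -/
theorem reg_span_singleton_mul {I : Ideal X.Coord} (hI : I.IsHomogeneous X.forms) {d : ℕ}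
    {a : X.Coord} (ha : a ∈ X.forms d) (h0 : a ≠ 0) :
    X.reg (Ideal.span {a} * I) = X.reg I + ((d : ℝ) : EReal) := by
  let φ : I →ₗ[X.Coord] ↥(Ideal.span {a} * I) :=
    ((LinearMap.mulLeft X.Coord a).comp I.subtype).codRestrict (Ideal.span {a} * I) fun l =>
      Ideal.mul_mem_mul (Ideal.mem_span_singleton_self a) l.2
  have hφ : ∀ l, (φ l : X.Coord) = a * l := fun l => rfl
  have hbij : Function.Bijective φ := by
    constructor
    · intro l l' h
      have := congrArg Subtype.val h
      rw [hφ, hφ] at this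
      exact Subtype.ext (mul_left_cancel₀ h0 this)
    · rintro ⟨q, hq⟩
      obtain ⟨z, hz, rfl⟩ := Ideal.mem_span_singleton_mul.1 hq
      exact ⟨⟨z, hz⟩, rfl⟩
  have hJ : (Ideal.span {a} * I).IsHomogeneous X.forms := (isHomogeneous_span_singleton ha).mul hI
  have := Cech.reg_eq_add_of_bijective (x := X.var) (ℒ := X.idealDeg I)
    (fun i => by simpa using smulDeg_ideal (Ideal.span {a} * I) 1 _ (X.var_mem_forms i))
    (idealGrading hJ) hbij (d := d) (fun {e l} => ⟨fun h => ?_, fun h => ?_⟩)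
  · rw [Int.cast_natCast] at this
    exact this
  -- The degree of l is recovered from that of a l because a is a nonzerodivisor on A.
  · exact Cech.mem_of_smul_mem X.grading (X.smulDeg_forms d a ha)
      (fun m hm => (mul_eq_zero.1 hm).resolve_left h0) h
  · exact X.smulDeg_forms d a ha h

/-! ### Comparison of two base ideals of one rational map. -/

namespace RationalMap

variable {m : ℕ} {F : X.RationalMap m} {I J : Ideal X.Coord} {δI δJ : ℕ}

theorem IsBaseIdeal.isHomogeneous (hI : F.IsBaseIdeal δI I) : I.IsHomogeneous X.forms := by
  obtain ⟨f, hf, rfl⟩ := hI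
  refine Ideal.homogeneous_span _ _ ?_
  rintro _ ⟨j, rfl⟩
  exact ⟨δI, hf.1 j⟩

theorem IsBaseIdeal.ne_bot (hI : F.IsBaseIdeal δI I) : I ≠ ⊥ := by
  obtain ⟨f, ⟨-, h, -⟩, rfl⟩ := hI
  rw [Ne, Ideal.span_eq_bot]
  intro h0
  exact h (funext fun j => by rw [h0 _ ⟨j, rfl⟩, map_zero]; rfl)

theorem IsBaseIdeal.exists_reg_pow_eq (hI : F.IsBaseIdeal δI I) (r : ℕ) :
    ∃ a : ℤ, X.reg (I ^ r) = ((a : ℝ) : EReal) :=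
  exists_reg_eq (isHomogeneous_pow hI.isHomogeneous r) (pow_ne_zero (M₀ := Ideal X.Coord) r hI.ne_bot)

theorem exists_span_singleton_mul_eq (hI : F.IsBaseIdeal δI I) (hJ : F.IsBaseIdeal δJ J) :
    ∃ a ∈ X.forms δI, ∃ b ∈ X.forms δJ, a ≠ 0 ∧ b ≠ 0 ∧
      Ideal.span {b} * I = Ideal.span {a} * J := by
  obtain ⟨f, ⟨hf, hf0, hfP⟩, rfl⟩ := hI
  obtain ⟨g, ⟨hg, hg0, hgP⟩, rfl⟩ := hJ
  rw [← hgP, Projectivization.mk_eq_mk_iff'] at hfP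
  obtain ⟨c, hc⟩ := hfP
  have hinj : Function.Injective (algebraMap X.Coord X.K) := IsFractionRing.injective _ _
  have hc' : ∀ j, algebraMap X.Coord X.K (f j) = c * algebraMap X.Coord X.K (g j) :=
    fun j => (congrFun hc j).symm
  -- The proportionality factor c lies only in K(A); cross-multiplying with the coordinates at i,
  -- where f_i ≠ 0, brings the relation back to A.
  obtain ⟨i, hi⟩ := Function.ne_iff.1 hf0
  have hmul : ∀ j, g i * f j = f i * g j := fun j => hinj (by
    rw [map_mul, map_mul, hc' i, hc' j]; ring)
  refine ⟨f i, hf i, g i, hg i, fun h => hi (by rw [h, map_zero]; rfl), fun h => hi ?_, ?_⟩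
  · rw [hc' i, h, map_zero, mul_zero]; rfl
  · rw [Ideal.span_mul_span', Ideal.span_mul_span', Set.singleton_mul, Set.singleton_mul,
      ← Set.range_comp, ← Set.range_comp]
    congr 2
    exact funext hmul

/-- The additive form is free of any finiteness assumption; subtraction in `EReal` is not. -/
theorem reg_pow_add (hI : F.IsBaseIdeal δI I) (hJ : F.IsBaseIdeal δJ J) (r : ℕ) :
    X.reg (I ^ r) + ((r * δJ : ℝ) : EReal) = X.reg (J ^ r) + ((r * δI : ℝ) : EReal) := by
  obtain ⟨a, ha, b, hb, ha0, hb0, h⟩ := exists_span_singleton_mul_eq hI hJ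
  have h1 := reg_span_singleton_mul (isHomogeneous_pow hI.isHomogeneous r)
    (SetLike.pow_mem_graded r hb) (pow_ne_zero r hb0)
  have h2 := reg_span_singleton_mul (isHomogeneous_pow hJ.isHomogeneous r)
    (SetLike.pow_mem_graded r ha) (pow_ne_zero r ha0)
  have hmul : ∀ I J : Ideal X.Coord, (I * J) ^ r = I ^ r * J ^ r := fun I J => mul_pow I J r
  rw [← Ideal.span_singleton_pow, ← hmul] at h1 h2
  rw [h, h2] at h1
  simpa using h1.symm

end RationalMap

end ProjVariety
end

theorem mainTheorem7 {k : Type*} [Field k] {n m : ℕ} (X : ProjVariety k n) (F : X.RationalMap m) :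
    (∀ (I J : Ideal X.Coord) (δI δJ : ℕ), F.IsBaseIdeal δI I → F.IsBaseIdeal δJ J →
      ∀ r : ℕ, 1 ≤ r →
        X.reg (I ^ r) - ((r * δI : ℝ) : EReal) = X.reg (J ^ r) - ((r * δJ : ℝ) : EReal)) ∧
    ∃ f : ℕ → ℤ, ∀ (I : Ideal X.Coord) (δ : ℕ), F.IsBaseIdeal δ I →
      ∀ r : ℕ, 1 ≤ r → X.reg (I ^ r) - ((r * δ : ℝ) : EReal) = ((f r : ℝ) : EReal) := by
  have key : ∀ (I J : Ideal X.Coord) (δI δJ : ℕ), F.IsBaseIdeal δI I → F.IsBaseIdeal δJ J →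
      ∀ r : ℕ, X.reg (I ^ r) - ((r * δI : ℝ) : EReal) =
        X.reg (J ^ r) - ((r * δJ : ℝ) : EReal) := by
    intro I J δI δJ hI hJ r
    have h := ProjVariety.RationalMap.reg_pow_add hI hJ r
    obtain ⟨a, ha⟩ := hI.exists_reg_pow_eq r
    obtain ⟨b, hb⟩ := hJ.exists_reg_pow_eq r
    -- Both regularities are integers, so the identity can be rearranged in ℝ.
    rw [ha, hb, ← EReal.coe_add, ← EReal.coe_add, EReal.coe_eq_coe_iff] at h
    rw [ha, hb, ← EReal.coe_sub, ← EReal.coe_sub, EReal.coe_eq_coe_iff]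
    linarith
  refine ⟨fun I J δI δJ hI hJ r _ => key I J δI δJ hI hJ r, ?_⟩
  obtain ⟨δ₀, f₀, hf₀⟩ := F.exists_representative
  have hI₀ : F.IsBaseIdeal δ₀ (Ideal.span (Set.range f₀)) := ⟨f₀, hf₀, rfl⟩
  choose a ha using hI₀.exists_reg_pow_eq
  refine ⟨fun r => a r - r * δ₀, fun I δ hI r _ => ?_⟩
  rw [key I _ δ δ₀ hI hI₀ r, ha, ← EReal.coe_sub]
  exact congrArg Real.toEReal (by push_cast; ring)
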